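/- **Setting.** Let $n,p\ge 1$ be integers. Let $X,X_1,\dots,X_n\in\mathbb R^p$ be identically distributed centered random vectors, with $X_1,\dots,X_n$ independent, and with covariance matrix $$\Sigma=\mathbb E[XX^\top]=\sigma_1\theta_1\theta_1^\top+\sigma_2\Upsilon ,$$ where $\sigma_1>\sigma_2\ge 0$, $\theta_1$ belongs to the Euclidean unit sphere $\mathcal S^p$ of $\mathbb R^p$, and $\Upsilon$ is a symmetric positive semidefinite $p\times p$ matrix with spectral norm at most $1$ and $\Upsilon\theta_1=0$. For a real random variable $V$ put $\|V\|_{\psi_2}=\inf\{u>0:\mathbb E\exp(V^2/u^2)\le 2\}$. Assume that $X$ is sub-Gaussian, $\sup_{u\in\mathcal S^p}\|\langle X,u\rangle\|_{\psi_2}<\infty$, and that for some constant $c_1>0$ $$\mathbb E\langle X,u\rangle^2\ \ge\ c_1\|\langle X,u\rangle\|_{\psi_2}^2\qquad\text{for all }u\in\mathbb R^p .$$ Let $\delta\in(0,1]$, let $(\delta_{i,j})_{1\le i\le n,\,1\le j\le p}$ be i.i.d. Bernoulli random variables with parameter $\delta$, independent of $(X_1,\dots,X_n)$, and let $Y_1,\dots,Y_n\in\mathbb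 R^p$ be the vectors with coordinates $Y_i^{(j)}=\delta_{i,j}X_i^{(j)}$. Put $$\Sigma_n^{(\delta)}=\frac1n\sum_{i=1}^nY_iY_i^\top,\qquad \tilde\Sigma_n=(\delta^{-1}-\delta^{-2})\,\mathrm{diag}(\Sigma_n^{(\delta)})+\delta^{-2}\Sigma_n^{(\delta)} .$$ Write $|\theta|_0$ for the number of nonzero coordinates of $\theta$, and $\|A\|_2=\sqrt{\mathrm{tr}(A^\top A)}$ for the Schatten $2$-norm of a matrix. **Theorem.** For every $c_1>0$ there is $C_0>0$, depending only on $c_1$, such that for every $C\ge C_0$ there is $C'>0$, depending only on $c_1$ and $C$, for which the following holds in every setting as above. Let $\bar s$ be a real number with $1\le\bar s\le p$ and $$n\ \ge\ \delta^{-2}(\bar s+1)\log(ep/\bar s),\qquad\text{and let}\qquad \lambda=C\,\frac{\sigma_1^2}{\sigma_1-\sigma_2}\,\frac{\log(ep)}{\delta^2n}.$$ If $|\theta_1|_0\le\bar s$, then the function $\theta\mapsto\theta^\top\tilde\Sigma_n\theta-\lambda|\theta|_0$ attains its maximum over $\{\theta\in\mathcal S^p:|\theta|_0\le\bar s\}$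 and, on an event of probability at least $1-\frac1p$, every maximizer $\hat\theta_1$ satisfies $$\|\hat\theta_1\hat\theta_1^\top-\theta_1\theta_1^\top\|_2^2\ \le\ C'\,|\theta_1|_0\left(\frac{\sigma_1}{\sigma_1-\sigma_2}\right)^2\frac{\log(ep)}{\delta^2n}.$$ In particular $\hat\theta_1$ adapts to the unknown sparsity of $\theta_1$: neither $\lambda$, $C$ nor $C'$ depends on $|\theta_1|_0$. -/

import Mathlib

open MeasureTheory ProbabilityTheory
open scoped ENNReal Matrix

noncomputable section

/-- The `ψ₂`-norm `inf {u > 0 : E exp (V² / u²) ≤ 2}` of a real random variable, with values in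
`[0, ∞]` (it is `∞` when no such `u` exists). -/
def psi2Norm {Ω : Type*} [MeasurableSpace Ω] (V : Ω → ℝ) (μ : Measure Ω) : ℝ≥0∞ :=
  ⨅ (u : ℝ) (_ : 0 < u ∧ ∫⁻ ω, ENNReal.ofReal (Real.exp (|V ω| ^ 2 / u ^ 2)) ∂μ ≤ 2),
    ENNReal.ofReal u

/-- The Euclidean unit sphere of `ℝᵖ`. -/
def unitSphere (p : ℕ) : Set (Fin p → ℝ) := {θ | ∑ j, θ j ^ 2 = 1}

/-- The `ψ₂`-norm of a random vector: the supremum over unit vectors `u` of the `ψ₂`-norm of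
`⟨X, u⟩`. -/
def psi2NormVec {Ω : Type*} [MeasurableSpace Ω] {p : ℕ} (X : Ω → Fin p → ℝ) (μ : Measure Ω) :
    ℝ≥0∞ :=
  ⨆ u ∈ unitSphere p, psi2Norm (fun ω => X ω ⬝ᵥ u) μ

/-- Sub-Gaussian observations with constant `c₁`: `‖X‖_{ψ₂} < ∞`, and
`c₁ ‖⟨X, u⟩‖_{ψ₂}² ≤ E ⟨X, u⟩²` for every `u ∈ ℝᵖ`. -/
def SubGaussianObservations {Ω : Type*} [MeasurableSpace Ω] {p : ℕ} (c₁ : ℝ)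
    (X : Ω → Fin p → ℝ) (μ : Measure Ω) : Prop :=
  psi2NormVec X μ < ∞ ∧
    ∀ u : Fin p → ℝ, ENNReal.ofReal c₁ * psi2Norm (fun ω => X ω ⬝ᵥ u) μ ^ 2 ≤
      ∫⁻ ω, ENNReal.ofReal ((X ω ⬝ᵥ u) ^ 2) ∂μ

/-- The matrix `E[X Xᵀ]`, which is the covariance matrix of a centered random vector. -/
def secondMomentMatrix {Ω : Type*} [MeasurableSpace Ω] {p : ℕ} (X : Ω → Fin p → ℝ)
    (μ : Measure Ω) : Matrix (Fin p) (Fin p) ℝ :=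
  Matrix.of fun j k => ∫ ω, X ω j * X ω k ∂μ

/-- The covariance model `Σ = σ₁ θ₁ θ₁ᵀ + σ₂ Υ` with `σ₁ > σ₂ ≥ 0`, `θ₁` a unit vector, and `Υ`
symmetric positive semidefinite with spectral norm at most `1` and `Υ θ₁ = 0`. -/
def IsSpikedCovariance {p : ℕ} (S : Matrix (Fin p) (Fin p) ℝ) (σ₁ σ₂ : ℝ) (θ₁ : Fin p → ℝ) :
    Prop :=
  0 ≤ σ₂ ∧ σ₂ < σ₁ ∧ θ₁ ∈ unitSphere p ∧
    ∃ Υ : Matrix (Fin p) (Fin p) ℝ, Υ.PosSemidef ∧ ‖Matrix.toEuclideanCLM (𝕜 := ℝ) Υ‖ ≤ 1 ∧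
      Υ *ᵥ θ₁ = 0 ∧ S = σ₁ • Matrix.vecMulVec θ₁ θ₁ + σ₂ • Υ

/-- The masked data `Y_i^{(j)} = δ_{i,j} X_i^{(j)}`, for one realisation of data and mask. -/
def maskedData {n p : ℕ} (x m : Fin n → Fin p → ℝ) : Fin n → Fin p → ℝ :=
  fun i j => m i j * x i j

/-- The empirical covariance matrix `(1/n) ∑ y_i y_iᵀ`. -/
def empiricalCov {n p : ℕ} (y : Fin n → Fin p → ℝ) : Matrix (Fin p) (Fin p) ℝ :=
  (n : ℝ)⁻¹ • ∑ i, Matrix.vecMulVec (y i) (y i)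

/-- The bias-corrected covariance matrix
`(δ⁻¹ - δ⁻²) diag(Σ_n^{(δ)}) + δ⁻² Σ_n^{(δ)}`. -/
def correctedCov {n p : ℕ} (δ : ℝ) (y : Fin n → Fin p → ℝ) : Matrix (Fin p) (Fin p) ℝ :=
  (δ⁻¹ - (δ ^ 2)⁻¹) • Matrix.diagonal (Matrix.diag (empiricalCov y))
    + (δ ^ 2)⁻¹ • empiricalCov y

/-- `θ` is a maximiser of `θᵀ S θ - lam |θ|₀` over the unit vectors with `|θ|₀ ≤ sbar`
(`hammingNorm θ` is the number of nonzero coordinates of `θ`). -/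
def IsSparsePCAEstimator {p : ℕ} (S : Matrix (Fin p) (Fin p) ℝ) (sbar lam : ℝ)
    (θ : Fin p → ℝ) : Prop :=
  θ ∈ {v | v ∈ unitSphere p ∧ (hammingNorm v : ℝ) ≤ sbar} ∧
    IsMaxOn (fun v => v ⬝ᵥ S *ᵥ v - lam * (hammingNorm v : ℝ))
      {v | v ∈ unitSphere p ∧ (hammingNorm v : ℝ) ≤ sbar} θ

/-- The Schatten 2-norm `√⟨A, A⟩ = √(tr (Aᵀ A))`. -/
def schattenTwo {p : ℕ} (A : Matrix (Fin p) (Fin p) ℝ) : ℝ := √(Matrix.trace (Aᵀ * A))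

end

/-! Write `T` for the covariance, `S` for the corrected empirical matrix and `D = 1 - ⟨θ, θ₁⟩²`; the
loss equals `2 * D`. The spectral gap gives curvature: `θᵀTθ ≤ θ₁ᵀTθ₁ - (σ₁ - σ₂) * D`. The noise
enters as a difference of two quadratic forms of `B = S - T`, which factors as `⟨θ - θ₁, B(θ + θ₁)⟩`
and is therefore at most `4 * c * √D`, where `c` bounds the form of `B` on a net of the sphere of
the joint support. Half the curvature absorbs `√D` and leaves a noise term of order `c² / (σ₁ -
σ₂)`. Since `c²` grows linearly in `|θ|₀ + |θ₁|₀`, this is at most `lam * (|θ|₀ + |θ₁|₀)`; the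
penalty cancels the `|θ|₀` part and `2 * lam * |θ₁|₀` remains. That cancellation is the adaptation
to the unknown sparsity.

The level `c` must scale like `1/δ`, not `1/δ²`. For a fixed direction, the off-diagonal part of one
observation's form is an average, over splittings of the coordinates into two blocks, of products of
two linear forms with disjoint masks. Such a product has second moment of order `δ²`, which offsets
two of the four powers of `1/δ` (`IsBernoulliMask.integral_block_le`). Jensen's inequality
recombines the blocks with the diagonal in `lintegral_exp_sampleForm_le`. Chernoff's bound and a
union bound over supports and nets then give the uniform event (`measure_exists_support_le`), and
`two_mul_le_of_basic_inequality` concludes. -/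

open scoped RealInnerProductSpace

/-! ### Nets of the unit sphere by volume comparison -/

/-- A `1/4`-separated subset of the unit ball has at most `9 ^ dim` points. -/
theorem card_le_nine_pow_finrank_of_separated {E : Type*} [NormedAddCommGroup E]
    [NormedSpace ℝ E] [FiniteDimensional ℝ E] (s : Finset E) (hs : ∀ c ∈ s, ‖c‖ ≤ 1)
    (h : ∀ c ∈ s, ∀ d ∈ s, c ≠ d → 1 / 4 ≤ ‖c - d‖) :
    s.card ≤ 9 ^ Module.finrank ℝ E := by
  borelize E
  let μ : Measure E := Measure.addHaar
  have D : Set.Pairwise (s : Set E)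
      (Function.onFun Disjoint fun c => Metric.ball (c : E) (1 / 8)) := by
    rintro c hc d hd hcd
    apply Metric.ball_disjoint_ball
    rw [dist_eq_norm]
    exact le_trans (by norm_num) (h c hc d hd hcd)
  have A_subset : (⋃ c ∈ s, Metric.ball (c : E) (1 / 8)) ⊆ Metric.ball (0 : E) (9 / 8) := by
    refine Set.iUnion₂_subset fun x hx => Metric.ball_subset_ball' ?_
    rw [dist_zero_right]
    linarith [hs x hx]
  have I : (s.card : ℝ≥0∞) * ENNReal.ofReal ((1 / 8) ^ Module.finrank ℝ E) *
      μ (Metric.ball 0 1) ≤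
      ENNReal.ofReal ((9 / 8) ^ Module.finrank ℝ E) * μ (Metric.ball 0 1) := by
    have h₁ := measure_mono (μ := μ) A_subset
    rw [measure_biUnion_finset D fun c _ => measurableSet_ball] at h₁
    simpa only [μ.addHaar_ball_of_pos _ (by norm_num : (0 : ℝ) < 1 / 8),
      μ.addHaar_ball_of_pos _ (by norm_num : (0 : ℝ) < 9 / 8), Finset.sum_const, nsmul_eq_mul,
      mul_assoc] using h₁
  have J := (ENNReal.mul_le_mul_iff_left (Metric.measure_ball_pos _ _ zero_lt_one).ne'
    measure_ball_lt_top.ne).1 I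
  have K : (s.card : ℝ) ≤ (9 : ℝ) ^ Module.finrank ℝ E := by
    have h₂ := ENNReal.toReal_le_of_le_ofReal (by positivity) J
    rw [ENNReal.toReal_mul, ENNReal.toReal_ofReal (by positivity), ENNReal.toReal_natCast] at h₂
    rw [div_pow, div_pow, one_pow, mul_one_div] at h₂
    exact (div_le_div_iff_of_pos_right (by positivity)).1 h₂
  exact mod_cast K

/-- The unit sphere has a `1/4`-net of at most `9 ^ dim` points. -/
theorem exists_quarter_net_sphere (E : Type*) [NormedAddCommGroup E]
    [NormedSpace ℝ E] [FiniteDimensional ℝ E] :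
    ∃ N : Finset E, N.card ≤ 9 ^ Module.finrank ℝ E ∧ (∀ y ∈ N, ‖y‖ = 1) ∧
      ∀ x : E, ‖x‖ = 1 → ∃ y ∈ N, ‖x - y‖ ≤ 1 / 4 := by
  classical
  let P : Finset E → Prop := fun s => (∀ c ∈ s, ‖c‖ = 1) ∧
    ∀ c ∈ s, ∀ d ∈ s, c ≠ d → 1 / 4 ≤ ‖c - d‖
  have hP : ∀ s, P s → s.card ≤ 9 ^ Module.finrank ℝ E := fun s hs =>
    card_le_nine_pow_finrank_of_separated s (fun c hc => (hs.1 c hc).le) hs.2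
  -- A separated set of largest cardinality is a net: a point far from all of it could be added.
  obtain ⟨k, ⟨N, hN, hk⟩, hmax⟩ : ∃ k, (∃ s, P s ∧ s.card = k) ∧
      ∀ s, P s → s.card ≤ k := by
    have hex : ∃ k, ∃ s, P s ∧ s.card = k := ⟨0, ∅, by simp [P], rfl⟩
    have hb : ∀ m, (∃ s, P s ∧ s.card = m) → m ≤ 9 ^ Module.finrank ℝ E := by
      rintro m ⟨s, hs, rfl⟩
      exact hP s hs
    obtain ⟨m, hm⟩ := hex
    refine ⟨Nat.findGreatest (fun m => ∃ s, P s ∧ s.card = m) (9 ^ Module.finrank ℝ E),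
      Nat.findGreatest_spec (P := fun m => ∃ s, P s ∧ s.card = m) (hb m hm) hm,
      fun s hs => Nat.le_findGreatest (hP s hs) ⟨s, hs, rfl⟩⟩
  refine ⟨N, hP N hN, hN.1, fun x hx => ?_⟩
  by_contra! hcon
  have hx' : x ∉ N := fun hxN => by
    have h₁ := hcon x hxN
    simp at h₁
    linarith
  have h₂ := hmax (insert x N) ⟨by
    intro c hc
    rcases Finset.mem_insert.1 hc with rfl | hc
    · exact hx
    · exact hN.1 c hc, by
    intro c hc d hd hcd
    rcases Finset.mem_insert.1 hc with rfl | hc' <;> rcases Finset.mem_insert.1 hd with rfl | hd'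
    · exact absurd rfl hcd
    · exact (hcon d hd').le
    · rw [norm_sub_rev]; exact (hcon c hc').le
    · exact hN.2 c hc' d hd' hcd⟩
  rw [Finset.card_insert_of_notMem hx'] at h₂
  omega

/-! ### Symmetric quadratic forms: polarization and nets -/

section QuadraticForm

variable {H : Type*} [NormedAddCommGroup H] [InnerProductSpace ℝ H]

theorem inner_add_sub_eq_of_isSymmetric {T : H →L[ℝ] H} (hT : (T : H →ₗ[ℝ] H).IsSymmetric)
    (x y : H) : ⟪x - y, T (x + y)⟫ = ⟪x, T x⟫ - ⟪y, T y⟫ := by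
  have h₁ : ⟪x, T y⟫ = ⟪y, T x⟫ := by
    rw [real_inner_comm]
    exact hT y x
  simp only [map_add, inner_add_right, inner_sub_left]
  linarith

/-- Polarization: a bound on the quadratic form bounds the bilinear form. -/
theorem abs_inner_le_of_abs_quadraticForm_le {T : H →L[ℝ] H}
    (hT : (T : H →ₗ[ℝ] H).IsSymmetric) {W : Submodule ℝ H} {M : ℝ}
    (hM : ∀ w ∈ W, |⟪w, T w⟫| ≤ M * ‖w‖ ^ 2) {x y : H} (hx : x ∈ W) (hy : y ∈ W) :
    |⟪x, T y⟫| ≤ M * ‖x‖ * ‖y‖ := by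
  rcases eq_or_ne x 0 with rfl | hx0
  · simp
  rcases eq_or_ne y 0 with rfl | hy0
  · simp
  have hsym : ⟪x, T y⟫ = ⟪y, T x⟫ := by
    rw [real_inner_comm]
    exact hT y x
  have hxn : 0 < ‖x‖ := norm_pos_iff.2 hx0
  have hyn : 0 < ‖y‖ := norm_pos_iff.2 hy0
  -- Rescaling gives both vectors the length `‖x‖ * ‖y‖`, so that polarization loses no constant.
  have h₁ := hM (‖y‖ • x + ‖x‖ • y) (W.add_mem (W.smul_mem _ hx) (W.smul_mem _ hy))
  have h₂ := hM (‖y‖ • x - ‖x‖ • y) (W.sub_mem (W.smul_mem _ hx) (W.smul_mem _ hy))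
  have hpar : ‖‖y‖ • x + ‖x‖ • y‖ ^ 2 + ‖‖y‖ • x - ‖x‖ • y‖ ^ 2 = 4 * (‖x‖ * ‖y‖) ^ 2 := by
    have h₃ := parallelogram_law_with_norm ℝ (‖y‖ • x) (‖x‖ • y)
    simp only [norm_smul, norm_norm] at h₃
    nlinarith
  have hdiff : ⟪‖y‖ • x + ‖x‖ • y, T (‖y‖ • x + ‖x‖ • y)⟫
      - ⟪‖y‖ • x - ‖x‖ • y, T (‖y‖ • x - ‖x‖ • y)⟫ = 4 * (‖x‖ * ‖y‖) * ⟪x, T y⟫ := by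
    simp only [map_add, map_sub, map_smul, inner_add_left, inner_add_right, inner_sub_left,
      inner_sub_right, real_inner_smul_left, real_inner_smul_right]
    rw [← hsym]
    ring
  have hpos : 0 < 4 * (‖x‖ * ‖y‖) := by positivity
  have h₄ : |4 * (‖x‖ * ‖y‖) * ⟪x, T y⟫| ≤ M * (4 * (‖x‖ * ‖y‖) ^ 2) := by
    rw [← hdiff, ← hpar, mul_add]
    exact (abs_sub _ _).trans (add_le_add h₁ h₂)
  rw [abs_mul, abs_of_pos hpos] at h₄
  nlinarith

/-- A bound of a symmetric quadratic form on a `1/4`-net of the unit sphere of a finite-dimensional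
subspace extends to the subspace at the cost of a factor `2`. -/
theorem abs_quadraticForm_le_of_quarter_net {T : H →L[ℝ] H}
    (hT : (T : H →ₗ[ℝ] H).IsSymmetric) {W : Submodule ℝ H} [FiniteDimensional ℝ W]
    {N : Finset W} (hN₁ : ∀ y ∈ N, ‖y‖ = 1)
    (hN : ∀ x : W, ‖x‖ = 1 → ∃ y ∈ N, ‖x - y‖ ≤ 1 / 4) {c : ℝ}
    (hc : ∀ v ∈ N, |⟪(v : H), T v⟫| ≤ c) {w : H} (hw : w ∈ W) :
    |⟪w, T w⟫| ≤ 2 * c * ‖w‖ ^ 2 := by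
  rcases eq_or_ne w 0 with rfl | hw0
  · simp
  have hunit : ‖(⟨‖w‖⁻¹ • w, W.smul_mem _ hw⟩ : W)‖ = 1 := by
    simp [norm_smul, hw0]
  obtain ⟨z, hz, hzmax⟩ := (isCompact_sphere (0 : W) 1).exists_isMaxOn
    ⟨⟨‖w‖⁻¹ • w, W.smul_mem _ hw⟩, by simpa using hunit⟩
    (f := fun v : W => |⟪(v : H), T v⟫|) (by fun_prop)
  have hz1 : ‖z‖ = 1 := by simpa using hz
  set M := |⟪(z : H), T z⟫| with hMdef
  have hM : ∀ v ∈ W, |⟪v, T v⟫| ≤ M * ‖v‖ ^ 2 := by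
    intro v hv
    rcases eq_or_ne v 0 with rfl | hv0
    · simp
    have h₁ : ‖(⟨‖v‖⁻¹ • v, W.smul_mem _ hv⟩ : W)‖ = 1 := by
      simp [norm_smul, hv0]
    have h₂ : |⟪‖v‖⁻¹ • v, T (‖v‖⁻¹ • v)⟫| ≤ M :=
      hzmax (a := ⟨‖v‖⁻¹ • v, W.smul_mem _ hv⟩) (by simpa using h₁)
    rw [map_smul, real_inner_smul_left, real_inner_smul_right, ← mul_assoc, abs_mul,
      abs_of_nonneg (by positivity)] at h₂
    have hvn : 0 < ‖v‖ := norm_pos_iff.2 hv0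
    have h₃ : |⟪v, T v⟫| = (‖v‖⁻¹ * ‖v‖⁻¹ * |⟪v, T v⟫|) * ‖v‖ ^ 2 := by
      field_simp
    rw [h₃]
    gcongr
  obtain ⟨y, hy, hzy⟩ := hN z hz1
  have h₁ := abs_inner_le_of_abs_quadraticForm_le hT hM (W.sub_mem z.2 y.2) (W.add_mem z.2 y.2)
  rw [inner_add_sub_eq_of_isSymmetric hT] at h₁
  have h₂ : ‖(z : H) - y‖ ≤ 1 / 4 := hzy
  have h₃ : ‖(z : H) + y‖ ≤ 2 := by
    refine (norm_add_le _ _).trans ?_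
    have := hN₁ y hy
    simp only [Submodule.coe_norm] at this hz1
    linarith
  have hM0 : 0 ≤ M := abs_nonneg _
  have h₄ : M * ‖(z : H) - y‖ * ‖(z : H) + y‖ ≤ M * (1 / 4) * 2 := by gcongr
  have h₅ : M ≤ |⟪(z : H), T z⟫ - ⟪(y : H), T y⟫| + |⟪(y : H), T y⟫| := by
    have := abs_add_le (⟪(z : H), T z⟫ - ⟪(y : H), T y⟫) ⟪(y : H), T y⟫
    rwa [sub_add_cancel] at this
  -- The maximum `M` satisfies `M ≤ M * (1 / 4) * 2 + c`.
  have h₆ : M ≤ 2 * c := by linarith [hc y hy]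
  exact (hM w hw).trans (by gcongr)

end QuadraticForm

/-! ### Unit vectors with a common support and the distance of their projectors -/

theorem mem_unitSphere_iff {p : ℕ} {v : Fin p → ℝ} : v ∈ unitSphere p ↔ v ⬝ᵥ v = 1 := by
  simp [unitSphere, dotProduct, sq]

theorem inner_toLp_eq_dotProduct {p : ℕ} (x y : Fin p → ℝ) :
    ⟪WithLp.toLp 2 x, WithLp.toLp 2 y⟫ = x ⬝ᵥ y := by
  rw [EuclideanSpace.inner_toLp_toLp, star_trivial, dotProduct_comm]

theorem norm_toLp_sq {p : ℕ} (x : Fin p → ℝ) : ‖WithLp.toLp 2 x‖ ^ 2 = x ⬝ᵥ x := by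
  rw [← real_inner_self_eq_norm_sq, inner_toLp_eq_dotProduct]

theorem inner_toEuclideanCLM {p : ℕ} (B : Matrix (Fin p) (Fin p) ℝ) (x y : Fin p → ℝ) :
    ⟪WithLp.toLp 2 x, Matrix.toEuclideanCLM (𝕜 := ℝ) B (WithLp.toLp 2 y)⟫ = x ⬝ᵥ B *ᵥ y := by
  rw [Matrix.toEuclideanCLM_toLp, inner_toLp_eq_dotProduct]

theorem isSymmetric_toEuclideanCLM {p : ℕ} {B : Matrix (Fin p) (Fin p) ℝ} (hB : Bᵀ = B) :
    (Matrix.toEuclideanCLM (𝕜 := ℝ) B : EuclideanSpace ℝ (Fin p) →ₗ[ℝ] _).IsSymmetric := by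
  intro x y
  obtain ⟨x, rfl⟩ := (WithLp.equiv 2 _).symm.surjective x
  obtain ⟨y, rfl⟩ := (WithLp.equiv 2 _).symm.surjective y
  change ⟪Matrix.toEuclideanCLM (𝕜 := ℝ) B (WithLp.toLp 2 x), WithLp.toLp 2 y⟫
    = ⟪WithLp.toLp 2 x, Matrix.toEuclideanCLM (𝕜 := ℝ) B (WithLp.toLp 2 y)⟫
  rw [real_inner_comm, inner_toEuclideanCLM, inner_toEuclideanCLM, Matrix.dotProduct_mulVec,
    ← Matrix.mulVec_transpose, hB, dotProduct_comm]

theorem dotProduct_sub_self_mul_dotProduct_add_self {p : ℕ} {x y : Fin p → ℝ}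
    (hx : x ∈ unitSphere p) (hy : y ∈ unitSphere p) :
    (x - y) ⬝ᵥ (x - y) * ((x + y) ⬝ᵥ (x + y)) = 4 * (1 - (x ⬝ᵥ y) ^ 2) := by
  rw [mem_unitSphere_iff] at hx hy
  simp only [sub_dotProduct, dotProduct_sub, add_dotProduct, dotProduct_add, hx, hy,
    dotProduct_comm y x]
  ring

theorem one_sub_dotProduct_sq_nonneg {p : ℕ} {x y : Fin p → ℝ}
    (hx : x ∈ unitSphere p) (hy : y ∈ unitSphere p) : 0 ≤ 1 - (x ⬝ᵥ y) ^ 2 := by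
  have h := dotProduct_sub_self_mul_dotProduct_add_self hx hy
  have h₁ : 0 ≤ (x - y) ⬝ᵥ (x - y) * ((x + y) ⬝ᵥ (x + y)) := by
    rw [← norm_toLp_sq, ← norm_toLp_sq]
    positivity
  linarith

/-- A finite set of unit vectors which controls the quadratic forms on the vectors supported
in `J`. -/
theorem exists_net_controlling_quadraticForm {p : ℕ} (J : Finset (Fin p)) :
    ∃ N : Finset (Fin p → ℝ), N.card ≤ 9 ^ J.card ∧ (∀ v ∈ N, v ∈ unitSphere p) ∧
      ∀ B : Matrix (Fin p) (Fin p) ℝ, Bᵀ = B → ∀ c : ℝ, (∀ v ∈ N, |v ⬝ᵥ B *ᵥ v| ≤ c) →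
        ∀ x ∈ unitSphere p, ∀ y ∈ unitSphere p, (∀ j ∉ J, x j = 0) → (∀ j ∉ J, y j = 0) →
          |x ⬝ᵥ B *ᵥ x - y ⬝ᵥ B *ᵥ y| ≤ 4 * c * √(1 - (x ⬝ᵥ y) ^ 2) := by
  classical
  let b := EuclideanSpace.basisFun (Fin p) ℝ
  let W : Submodule ℝ (EuclideanSpace ℝ (Fin p)) := Submodule.span ℝ (J.image b)
  have hW : Module.finrank ℝ W ≤ J.card :=
    (finrank_span_finset_le_card _).trans Finset.card_image_le
  have hmem : ∀ x : Fin p → ℝ, (∀ j ∉ J, x j = 0) → WithLp.toLp 2 x ∈ W := by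
    intro x hx
    rw [← b.sum_repr (WithLp.toLp 2 x)]
    refine W.sum_mem fun j _ => ?_
    by_cases hj : j ∈ J
    · exact W.smul_mem _ (Submodule.subset_span (by simpa using ⟨j, hj, rfl⟩))
    · simp [b, hx j hj]
  -- The net is fixed before the matrix `B`, which will be random: the union bound needs a
  -- deterministic set.
  obtain ⟨N, hcard, hN₁, hN⟩ := exists_quarter_net_sphere W
  refine ⟨N.image fun v : W => WithLp.ofLp (v : EuclideanSpace ℝ (Fin p)),
    Finset.card_image_le.trans (hcard.trans (Nat.pow_le_pow_right (by norm_num) hW)), ?_, ?_⟩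
  · intro v hv
    obtain ⟨w, hw, rfl⟩ := Finset.mem_image.1 hv
    rw [mem_unitSphere_iff, ← norm_toLp_sq]
    have := hN₁ w hw
    simp only [Submodule.coe_norm] at this
    simp [this]
  · intro B hB c hc x hx y hy hxJ hyJ
    have hT := isSymmetric_toEuclideanCLM hB
    have hquad : ∀ w ∈ W, |⟪w, Matrix.toEuclideanCLM (𝕜 := ℝ) B w⟫| ≤ 2 * c * ‖w‖ ^ 2 := by
      intro w hw
      refine abs_quadraticForm_le_of_quarter_net hT hN₁ hN (fun v hv => ?_) hw
      have h₁ := hc _ (Finset.mem_image_of_mem _ hv)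
      rwa [← inner_toEuclideanCLM] at h₁
    have h₁ := abs_inner_le_of_abs_quadraticForm_le hT hquad
      (W.sub_mem (hmem x hxJ) (hmem y hyJ)) (W.add_mem (hmem x hxJ) (hmem y hyJ))
    rw [inner_add_sub_eq_of_isSymmetric hT, inner_toEuclideanCLM, inner_toEuclideanCLM,
      mul_assoc (2 * c)] at h₁
    -- The product of the two lengths vanishes for `y = x` and for `y = -x`, so the sign ambiguity
    -- of an eigenvector does no harm.
    have h₂ : ‖WithLp.toLp 2 x - WithLp.toLp 2 y‖ * ‖WithLp.toLp 2 x + WithLp.toLp 2 y‖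
        = 2 * √(1 - (x ⬝ᵥ y) ^ 2) := by
      rw [← sq_eq_sq₀ (by positivity) (by positivity), mul_pow, mul_pow,
        Real.sq_sqrt (one_sub_dotProduct_sq_nonneg hx hy), ← WithLp.toLp_sub, ← WithLp.toLp_add,
        norm_toLp_sq, norm_toLp_sq, dotProduct_sub_self_mul_dotProduct_add_self hx hy]
      norm_num
    rw [h₂] at h₁
    linarith

theorem schattenTwo_vecMulVec_sub_sq {p : ℕ} {x y : Fin p → ℝ}
    (hx : x ∈ unitSphere p) (hy : y ∈ unitSphere p) :
    schattenTwo (Matrix.vecMulVec x x - Matrix.vecMulVec y y) ^ 2 = 2 * (1 - (x ⬝ᵥ y) ^ 2) := by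
  have h : Matrix.trace ((Matrix.vecMulVec x x - Matrix.vecMulVec y y)ᵀ *
      (Matrix.vecMulVec x x - Matrix.vecMulVec y y)) = 2 * (1 - (x ⬝ᵥ y) ^ 2) := by
    rw [mem_unitSphere_iff] at hx hy
    simp only [Matrix.transpose_sub, Matrix.transpose_vecMulVec, sub_mul, mul_sub,
      Matrix.vecMulVec_mul_vecMulVec, Matrix.trace_sub,
      Matrix.trace_vecMulVec, hx, hy, dotProduct_comm y x, dotProduct_smul, smul_eq_mul]
    ring
  rw [schattenTwo, h, Real.sq_sqrt]
  have := one_sub_dotProduct_sq_nonneg hx hy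
  linarith

/-! ### Curvature of the population quadratic form -/

namespace IsSpikedCovariance

variable {p : ℕ} {S : Matrix (Fin p) (Fin p) ℝ} {σ₁ σ₂ : ℝ} {θ₁ : Fin p → ℝ}

/-- Split `v` into its component along `θ₁` and an orthogonal remainder `w`. As `Υ` kills `θ₁`, only
`w` meets `Υ`, and it contributes at most `σ₂ * ‖w‖²`, where `‖w‖²` is the squared sine of the
angle. -/
theorem quadraticForm_le (h : IsSpikedCovariance S σ₁ σ₂ θ₁) {v : Fin p → ℝ}
    (hv : v ∈ unitSphere p) :
    v ⬝ᵥ S *ᵥ v ≤ σ₁ - (σ₁ - σ₂) * (1 - (v ⬝ᵥ θ₁) ^ 2) := by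
  obtain ⟨h0, -, hθ, Υ, hpsd, hnorm, hker, rfl⟩ := h
  rw [mem_unitSphere_iff] at hv hθ
  have hsym : Υᵀ = Υ := by simpa [Matrix.IsHermitian] using hpsd.1
  set a := v ⬝ᵥ θ₁ with ha
  set w := v - a • θ₁ with hw
  have hww : w ⬝ᵥ w = 1 - a ^ 2 := by
    simp only [hw, sub_dotProduct, dotProduct_sub, smul_dotProduct, dotProduct_smul, hv, hθ,
      dotProduct_comm θ₁ v, ← ha, smul_eq_mul]
    ring
  have hvΥ : v ⬝ᵥ Υ *ᵥ v = w ⬝ᵥ Υ *ᵥ w := by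
    have h₁ : Υ *ᵥ w = Υ *ᵥ v := by
      rw [hw, Matrix.mulVec_sub, Matrix.mulVec_smul, hker, smul_zero, sub_zero]
    have h₂ : θ₁ ⬝ᵥ Υ *ᵥ v = 0 := by
      rw [Matrix.dotProduct_mulVec, ← Matrix.mulVec_transpose, hsym, hker, zero_dotProduct]
    rw [h₁, hw, sub_dotProduct, smul_dotProduct, h₂, smul_zero, sub_zero]
  have hle : w ⬝ᵥ Υ *ᵥ w ≤ 1 - a ^ 2 := by
    rw [← inner_toEuclideanCLM, ← hww, ← norm_toLp_sq]
    refine (real_inner_le_norm _ _).trans ?_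
    have h₁ := (Matrix.toEuclideanCLM (𝕜 := ℝ) Υ).le_of_opNorm_le hnorm (WithLp.toLp 2 w)
    nlinarith [norm_nonneg (WithLp.toLp 2 w)]
  have hexp : v ⬝ᵥ (σ₁ • Matrix.vecMulVec θ₁ θ₁ + σ₂ • Υ) *ᵥ v
      = σ₁ * a ^ 2 + σ₂ * (v ⬝ᵥ Υ *ᵥ v) := by
    rw [Matrix.add_mulVec, Matrix.smul_mulVec, Matrix.smul_mulVec, dotProduct_add,
      dotProduct_smul, dotProduct_smul, Matrix.vecMulVec_mulVec, dotProduct_smul,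
      dotProduct_comm θ₁ v]
    simp only [← ha, smul_eq_mul, MulOpposite.smul_eq_mul_unop, MulOpposite.unop_op]
    ring
  rw [hexp, hvΥ]
  nlinarith

theorem quadraticForm_self (h : IsSpikedCovariance S σ₁ σ₂ θ₁) : θ₁ ⬝ᵥ S *ᵥ θ₁ = σ₁ := by
  obtain ⟨-, -, hθ, Υ, -, -, hker, rfl⟩ := h
  rw [mem_unitSphere_iff] at hθ
  rw [Matrix.add_mulVec, Matrix.smul_mulVec, Matrix.smul_mulVec, hker, Matrix.vecMulVec_mulVec]
  simp [hθ, dotProduct_smul]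

end IsSpikedCovariance

/-! ### Exponential moments from a weighted second moment -/

theorem exp_le_one_add_add_sq_mul_exp_abs (z : ℝ) :
    Real.exp z ≤ 1 + z + z ^ 2 * Real.exp |z| := by
  have h := Complex.norm_exp_sub_sum_le_norm_mul_exp (z : ℂ) 2
  have h₁ : Complex.exp z - ∑ m ∈ Finset.range 2, (z : ℂ) ^ m / m.factorial
      = ((Real.exp z - (1 + z) : ℝ) : ℂ) := by
    simp [Finset.sum_range_succ]
  rw [h₁, Complex.norm_real, Complex.norm_real, Real.norm_eq_abs, Real.norm_eq_abs, sq_abs] at h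
  linarith [le_abs_self (Real.exp z - (1 + z))]

/-- A bound on the centered moment generating function at `1` by a weighted second moment. -/
theorem integrable_and_lintegral_exp_sub_integral_le {α : Type*} [MeasurableSpace α]
    {ρ : Measure α} [IsProbabilityMeasure ρ] {Z : α → ℝ} (hZ : Measurable Z) {b : ℝ} (hb : 0 ≤ b)
    (h : ∫⁻ a, ENNReal.ofReal (Z a ^ 2 * Real.exp |Z a|) ∂ρ ≤ ENNReal.ofReal b) :
    Integrable Z ρ ∧
      ∫⁻ a, ENNReal.ofReal (Real.exp (Z a - ∫ a', Z a' ∂ρ)) ∂ρ ≤ ENNReal.ofReal (Real.exp b) := by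
  have hg : Integrable (fun a => Z a ^ 2 * Real.exp |Z a|) ρ := by
    refine ⟨(by fun_prop : Measurable _).aestronglyMeasurable, ?_⟩
    rw [hasFiniteIntegral_iff_ofReal (ae_of_all _ fun a => by positivity)]
    exact h.trans_lt ENNReal.ofReal_lt_top
  have hgb : ∫ a, Z a ^ 2 * Real.exp |Z a| ∂ρ ≤ b := by
    rw [integral_eq_lintegral_of_nonneg_ae (ae_of_all _ fun a => by positivity)
      hg.aestronglyMeasurable]
    exact ENNReal.toReal_le_of_le_ofReal hb h
  have hZi : Integrable Z ρ := by
    refine ((integrable_const (1 : ℝ)).add hg).mono' hZ.aestronglyMeasurable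
      (ae_of_all _ fun a => ?_)
    have h₁ : 1 ≤ Real.exp |Z a| := Real.one_le_exp (abs_nonneg _)
    have h₂ : Z a ^ 2 ≤ Z a ^ 2 * Real.exp |Z a| := le_mul_of_one_le_right (sq_nonneg _) h₁
    simp only [Pi.add_apply, Real.norm_eq_abs]
    nlinarith [sq_abs (Z a), sq_nonneg (|Z a| - 1), abs_nonneg (Z a)]
  refine ⟨hZi, ?_⟩
  set m := ∫ a', Z a' ∂ρ
  have hi : Integrable (fun a => 1 + Z a + Z a ^ 2 * Real.exp |Z a|) ρ :=
    ((integrable_const _).add hZi).add hg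
  have h₁ : ∫⁻ a, ENNReal.ofReal (Real.exp (Z a)) ∂ρ ≤ ENNReal.ofReal (1 + m + b) := by
    calc _ ≤ ∫⁻ a, ENNReal.ofReal (1 + Z a + Z a ^ 2 * Real.exp |Z a|) ∂ρ :=
          lintegral_mono fun a => ENNReal.ofReal_le_ofReal (exp_le_one_add_add_sq_mul_exp_abs _)
      _ = ENNReal.ofReal (∫ a, (1 + Z a + Z a ^ 2 * Real.exp |Z a|) ∂ρ) :=
          (ofReal_integral_eq_lintegral_ofReal hi (ae_of_all _ fun a =>
            (Real.exp_pos _).le.trans (exp_le_one_add_add_sq_mul_exp_abs (Z a)))).symm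
      _ ≤ _ := by
          apply ENNReal.ofReal_le_ofReal
          have h₂ : ∫ a, (1 + Z a + Z a ^ 2 * Real.exp |Z a|) ∂ρ
              = ∫ a, (1 + Z a) ∂ρ + ∫ a, Z a ^ 2 * Real.exp |Z a| ∂ρ :=
            integral_add ((integrable_const _).add hZi) hg
          rw [h₂, integral_add (integrable_const _) hZi]
          simp only [integral_const, probReal_univ, smul_eq_mul, one_mul]
          linarith
  calc ∫⁻ a, ENNReal.ofReal (Real.exp (Z a - m)) ∂ρ
      = ENNReal.ofReal (Real.exp (-m)) * ∫⁻ a, ENNReal.ofReal (Real.exp (Z a)) ∂ρ := by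
        rw [← lintegral_const_mul _ (by fun_prop)]
        refine lintegral_congr fun a => ?_
        rw [← ENNReal.ofReal_mul (Real.exp_pos _).le, ← Real.exp_add]
        ring_nf
    -- `1 + m + b ≤ exp (m + b)`, so centering removes the mean exactly.
    _ ≤ ENNReal.ofReal (Real.exp (-m)) * ENNReal.ofReal (Real.exp (m + b)) := by
        gcongr
        refine h₁.trans (ENNReal.ofReal_le_ofReal ?_)
        linarith [Real.add_one_le_exp (m + b)]
    _ = ENNReal.ofReal (Real.exp b) := by
        rw [← ENNReal.ofReal_mul (Real.exp_pos _).le, ← Real.exp_add]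
        ring_nf

/-- Jensen's inequality for the exponential moment of a finite convex combination. -/
theorem lintegral_exp_sum_le {α ι : Type*} [MeasurableSpace α] [Fintype ι] {ρ : Measure α}
    {w : ι → ℝ} (hw : ∀ i, 0 ≤ w i) (hw₁ : ∑ i, w i = 1) {Z : ι → α → ℝ}
    (hZ : ∀ i, Measurable (Z i)) {B : ℝ}
    (h : ∀ i, ∫⁻ a, ENNReal.ofReal (Real.exp (Z i a)) ∂ρ ≤ ENNReal.ofReal B) :
    ∫⁻ a, ENNReal.ofReal (Real.exp (∑ i, w i * Z i a)) ∂ρ ≤ ENNReal.ofReal B := by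
  calc ∫⁻ a, ENNReal.ofReal (Real.exp (∑ i, w i * Z i a)) ∂ρ
      ≤ ∫⁻ a, ∑ i, ENNReal.ofReal (w i) * ENNReal.ofReal (Real.exp (Z i a)) ∂ρ := by
        refine lintegral_mono fun a => ?_
        have h₁ := convexOn_exp.map_sum_le (t := Finset.univ) (w := w) (p := fun i => Z i a)
          (fun i _ => hw i) hw₁ (fun i _ => Set.mem_univ _)
        simp only [smul_eq_mul] at h₁
        refine (ENNReal.ofReal_le_ofReal h₁).trans_eq ?_
        rw [ENNReal.ofReal_sum_of_nonneg fun i _ => mul_nonneg (hw i) (Real.exp_pos _).le]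
        exact Finset.sum_congr rfl fun i _ => ENNReal.ofReal_mul (hw i)
    _ = ∑ i, ENNReal.ofReal (w i) * ∫⁻ a, ENNReal.ofReal (Real.exp (Z i a)) ∂ρ := by
        rw [lintegral_finsetSum _ (fun i _ => by have := hZ i; fun_prop)]
        refine Finset.sum_congr rfl fun i _ => ?_
        rw [lintegral_const_mul _ (by have := hZ i; fun_prop)]
    _ ≤ ∑ i, ENNReal.ofReal (w i) * ENNReal.ofReal B := by
        gcongr with i
        exact h i
    _ = ENNReal.ofReal B := by
        rw [← Finset.sum_mul, ← ENNReal.ofReal_sum_of_nonneg fun i _ => hw i, hw₁,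
          ENNReal.ofReal_one, one_mul]

/-! ### Decoupling of the off-diagonal part -/

/-- Under uniform random signs the cross terms average to zero; the subset `I` is where the sign is
`+1`. The offset `c` makes the induction close, since a new index shifts it by `± y a`. -/
theorem sum_powerset_sq_signed_sum {ι : Type*} [DecidableEq ι] (y : ι → ℝ) (S : Finset ι) :
    ∀ c : ℝ, ∑ I ∈ S.powerset, (c + (2 * ∑ j ∈ I, y j - ∑ j ∈ S, y j)) ^ 2
      = 2 ^ S.card * (c ^ 2 + ∑ j ∈ S, y j ^ 2) := by
  induction S using Finset.induction_on with
  | empty => simp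
  | insert a S ha ih =>
    intro c
    rw [Finset.sum_powerset_insert ha, Finset.card_insert_of_notMem ha, Finset.sum_insert ha,
      Finset.sum_insert ha]
    have h₁ : ∑ I ∈ S.powerset, (c + (2 * ∑ j ∈ I, y j - (y a + ∑ j ∈ S, y j))) ^ 2
        = 2 ^ S.card * ((c - y a) ^ 2 + ∑ j ∈ S, y j ^ 2) := by
      rw [← ih]
      exact Finset.sum_congr rfl fun I _ => by ring
    have h₂ : ∑ I ∈ S.powerset, (c + (2 * ∑ j ∈ insert a I, y j - (y a + ∑ j ∈ S, y j))) ^ 2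
        = 2 ^ S.card * ((c + y a) ^ 2 + ∑ j ∈ S, y j ^ 2) := by
      rw [← ih]
      refine Finset.sum_congr rfl fun I hI => ?_
      rw [Finset.sum_insert fun h => ha (Finset.mem_powerset.1 hI h)]
      ring
    rw [h₁, h₂]
    ring

/-- Decoupling: the off-diagonal part of a square is an average over all partitions of the index
set into two blocks. -/
theorem sum_finset_mul_sum_compl {ι : Type*} [Fintype ι] [DecidableEq ι] (y : ι → ℝ) :
    ∑ I : Finset ι, 4 * ((∑ j ∈ I, y j) * ∑ j ∈ Iᶜ, y j)
      = 2 ^ Fintype.card ι * ((∑ j, y j) ^ 2 - ∑ j, y j ^ 2) := by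
  have h := sum_powerset_sq_signed_sum y Finset.univ 0
  rw [Finset.powerset_univ, Finset.card_univ] at h
  -- `4AB = (A + B)² - (A - B)²`, and `A - B` is the signed sum of the previous lemma.
  have h₁ : ∀ I : Finset ι, 4 * ((∑ j ∈ I, y j) * ∑ j ∈ Iᶜ, y j)
      = (∑ j, y j) ^ 2 - (0 + (2 * ∑ j ∈ I, y j - ∑ j, y j)) ^ 2 := by
    intro I
    rw [← Finset.sum_add_sum_compl I y]
    ring
  rw [Finset.sum_congr rfl fun I _ => h₁ I, Finset.sum_sub_distrib, h, Finset.sum_const,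
    Finset.card_univ, Fintype.card_finset, nsmul_eq_mul]
  push_cast
  ring

/-- With `y` the mean of `g²/κ` and `h²/κ`, the smallness of `s` bounds the exponential by `exp
(y/2)`, and `y² ≤ 8 * exp (y/2)`; the arithmetic-geometric mean inequality then separates `g` from
`h`. The factor `r²` is kept because its average over the mask carries the power of `δ`. -/
theorem sq_mul_exp_abs_mul_le {κ s r g h : ℝ} (hκ : 0 < κ) (hs : |s| * κ ≤ 1 / 2) (hr₀ : 0 ≤ r)
    (hr : r ≤ 1) :
    (s * (r * (g * h))) ^ 2 * Real.exp |s * (r * (g * h))|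
      ≤ 4 * (s * κ) ^ 2 * r ^ 2 * (Real.exp (g ^ 2 / κ) + Real.exp (h ^ 2 / κ)) := by
  set y := (g ^ 2 / κ + h ^ 2 / κ) / 2 with hy
  have hy0 : 0 ≤ y := by positivity
  have hgh : |g * h| ≤ κ * y := by
    have h₁ : κ * y = (g ^ 2 + h ^ 2) / 2 := by
      rw [hy]
      field_simp
    rw [h₁, abs_mul]
    nlinarith [sq_nonneg (|g| - |h|), sq_abs g, sq_abs h]
  have hz : |s * (r * (g * h))| ≤ |s| * κ * r * y := by
    rw [abs_mul, abs_mul, abs_of_nonneg hr₀]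
    calc |s| * (r * |g * h|) ≤ |s| * (r * (κ * y)) := by gcongr
      _ = _ := by ring
  have hz₁ : |s * (r * (g * h))| ≤ y / 2 := by
    refine hz.trans ?_
    calc |s| * κ * r * y ≤ 1 / 2 * 1 * y := by gcongr
      _ = y / 2 := by ring
  have hz₂ : (s * (r * (g * h))) ^ 2 ≤ (s * κ) ^ 2 * r ^ 2 * y ^ 2 := by
    rw [← sq_abs]
    calc |s * (r * (g * h))| ^ 2 ≤ (|s| * κ * r * y) ^ 2 := by gcongr
      _ = |s| ^ 2 * (κ ^ 2 * r ^ 2 * y ^ 2) := by ring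
      _ = _ := by rw [sq_abs]; ring
  have hy₂ : y ^ 2 ≤ 8 * Real.exp (y / 2) := by
    have := Real.quadratic_le_exp_of_nonneg (by positivity : 0 ≤ y / 2)
    nlinarith
  have he : Real.exp (y / 2) * Real.exp (y / 2)
      ≤ (Real.exp (g ^ 2 / κ) + Real.exp (h ^ 2 / κ)) / 2 := by
    have h₁ : Real.exp (g ^ 2 / κ) = Real.exp (g ^ 2 / κ / 2) ^ 2 := by
      rw [← Real.exp_nat_mul]; congr 1; push_cast; ring
    have h₂ : Real.exp (h ^ 2 / κ) = Real.exp (h ^ 2 / κ / 2) ^ 2 := by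
      rw [← Real.exp_nat_mul]; congr 1; push_cast; ring
    have h₃ : Real.exp (y / 2) * Real.exp (y / 2)
        = Real.exp (g ^ 2 / κ / 2) * Real.exp (h ^ 2 / κ / 2) := by
      rw [← Real.exp_add, ← Real.exp_add]; congr 1; rw [hy]; ring
    rw [h₁, h₂, h₃]
    nlinarith [sq_nonneg (Real.exp (g ^ 2 / κ / 2) - Real.exp (h ^ 2 / κ / 2))]
  calc (s * (r * (g * h))) ^ 2 * Real.exp |s * (r * (g * h))|
      ≤ ((s * κ) ^ 2 * r ^ 2 * (8 * Real.exp (y / 2))) * Real.exp (y / 2) := by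
        gcongr
        exact hz₂.trans (by gcongr)
    _ = 8 * ((s * κ) ^ 2 * r ^ 2) * (Real.exp (y / 2) * Real.exp (y / 2)) := by ring
    _ ≤ 8 * ((s * κ) ^ 2 * r ^ 2) * ((Real.exp (g ^ 2 / κ) + Real.exp (h ^ 2 / κ)) / 2) := by
        gcongr
    _ = _ := by ring

/-! ### Exponential moments of one masked observation -/

section OneSample

variable {p : ℕ} {ν π : Measure (Fin p → ℝ)} {κ : ℝ}

theorem dotProduct_self_nonneg (a : Fin p → ℝ) : 0 ≤ a ⬝ᵥ a := by
  rw [← norm_toLp_sq]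
  positivity

theorem dotProduct_self_pos {a : Fin p → ℝ} (ha : a ≠ 0) : 0 < a ⬝ᵥ a :=
  (dotProduct_self_nonneg a).lt_of_ne' fun h => ha (dotProduct_self_eq_zero.1 h)

theorem inv_sqrt_smul_mem_unitSphere {a : Fin p → ℝ} (ha : a ≠ 0) :
    (√(a ⬝ᵥ a))⁻¹ • a ∈ unitSphere p := by
  have h : 0 < a ⬝ᵥ a := dotProduct_self_pos ha
  rw [mem_unitSphere_iff, smul_dotProduct, dotProduct_smul, smul_eq_mul, smul_eq_mul, ← mul_assoc,
    ← mul_inv, Real.mul_self_sqrt h.le, inv_mul_cancel₀ h.ne']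

theorem lintegral_sq_mul_exp_dotProduct_le (hκ : 0 < κ)
    (hν : ∀ v ∈ unitSphere p, ∫⁻ x, ENNReal.ofReal (Real.exp ((x ⬝ᵥ v) ^ 2 / κ)) ∂ν ≤ 2)
    {s : ℝ} (hs : |s| * κ ≤ 1 / 2) {a b : Fin p → ℝ} (hab : a ⬝ᵥ a * (b ⬝ᵥ b) ≤ 1) :
    ∫⁻ x, ENNReal.ofReal ((s * ((x ⬝ᵥ a) * (x ⬝ᵥ b))) ^ 2 *
        Real.exp |s * ((x ⬝ᵥ a) * (x ⬝ᵥ b))|) ∂ν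
      ≤ ENNReal.ofReal (16 * (s * κ) ^ 2 * (a ⬝ᵥ a * (b ⬝ᵥ b))) := by
  rcases eq_or_ne a 0 with rfl | ha
  · simp
  rcases eq_or_ne b 0 with rfl | hb
  · simp
  have hA : 0 < a ⬝ᵥ a := dotProduct_self_pos ha
  have hB : 0 < b ⬝ᵥ b := dotProduct_self_pos hb
  set a' := (√(a ⬝ᵥ a))⁻¹ • a with ha'
  set b' := (√(b ⬝ᵥ b))⁻¹ • b with hb'
  set r := √(a ⬝ᵥ a) * √(b ⬝ᵥ b) with hrdef
  have hr₂ : r ^ 2 = a ⬝ᵥ a * (b ⬝ᵥ b) := by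
    rw [hrdef, mul_pow, Real.sq_sqrt hA.le, Real.sq_sqrt hB.le]
  have hr : r ≤ 1 := by
    rw [← hr₂] at hab
    exact (sq_le_one_iff₀ (by positivity)).1 hab
  have hfac : ∀ x : Fin p → ℝ, (x ⬝ᵥ a) * (x ⬝ᵥ b) = r * ((x ⬝ᵥ a') * (x ⬝ᵥ b')) := by
    intro x
    have h₁ := (Real.sqrt_pos.2 hA).ne'
    have h₂ := (Real.sqrt_pos.2 hB).ne'
    rw [ha', hb', hrdef, dotProduct_smul, dotProduct_smul, smul_eq_mul, smul_eq_mul]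
    field_simp
  calc _ ≤ ∫⁻ x, ENNReal.ofReal (4 * (s * κ) ^ 2 * r ^ 2) *
        (ENNReal.ofReal (Real.exp ((x ⬝ᵥ a') ^ 2 / κ)) +
          ENNReal.ofReal (Real.exp ((x ⬝ᵥ b') ^ 2 / κ))) ∂ν := by
        refine lintegral_mono fun x => ?_
        rw [hfac x, ← ENNReal.ofReal_add (Real.exp_pos _).le (Real.exp_pos _).le,
          ← ENNReal.ofReal_mul (by positivity)]
        exact ENNReal.ofReal_le_ofReal (sq_mul_exp_abs_mul_le hκ hs (by positivity) hr)
    _ = ENNReal.ofReal (4 * (s * κ) ^ 2 * r ^ 2) *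
        (∫⁻ x, ENNReal.ofReal (Real.exp ((x ⬝ᵥ a') ^ 2 / κ)) ∂ν +
          ∫⁻ x, ENNReal.ofReal (Real.exp ((x ⬝ᵥ b') ^ 2 / κ)) ∂ν) := by
        simp only [dotProduct]
        rw [lintegral_const_mul _ (by fun_prop), lintegral_add_left (by fun_prop)]
    _ ≤ ENNReal.ofReal (4 * (s * κ) ^ 2 * r ^ 2) * (2 + 2) := by
        gcongr
        · exact hν _ (inv_sqrt_smul_mem_unitSphere ha)
        · exact hν _ (inv_sqrt_smul_mem_unitSphere hb)
    _ = _ := by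
        rw [show (2 + 2 : ℝ≥0∞) = ENNReal.ofReal 4 by norm_num,
          ← ENNReal.ofReal_mul (by positivity), hr₂]
        congr 1
        ring

/-- The exponential moment of a centered product of two linear forms whose coefficients are
independent of the vector. -/
theorem integrable_and_lintegral_exp_mul_dotProduct_le [IsProbabilityMeasure ν]
    [IsProbabilityMeasure π] (hκ : 0 < κ)
    (hν : ∀ v ∈ unitSphere p, ∫⁻ x, ENNReal.ofReal (Real.exp ((x ⬝ᵥ v) ^ 2 / κ)) ∂ν ≤ 2)
    {s : ℝ} (hs : |s| * κ ≤ 1 / 2) {a b : (Fin p → ℝ) → Fin p → ℝ} (ha : Measurable a)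
    (hb : Measurable b) (hab : ∀ᵐ m ∂π, a m ⬝ᵥ a m * (b m ⬝ᵥ b m) ≤ 1) {d : ℝ}
    (hd : ∫ m, a m ⬝ᵥ a m * (b m ⬝ᵥ b m) ∂π ≤ d) :
    Integrable (fun z : (Fin p → ℝ) × (Fin p → ℝ) => s * ((z.1 ⬝ᵥ a z.2) * (z.1 ⬝ᵥ b z.2)))
        (ν.prod π) ∧
      ∫⁻ z, ENNReal.ofReal (Real.exp (s * ((z.1 ⬝ᵥ a z.2) * (z.1 ⬝ᵥ b z.2))
        - ∫ z' : (Fin p → ℝ) × (Fin p → ℝ), s * ((z'.1 ⬝ᵥ a z'.2) * (z'.1 ⬝ᵥ b z'.2))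
          ∂ν.prod π)) ∂ν.prod π
        ≤ ENNReal.ofReal (Real.exp (16 * (s * κ) ^ 2 * d)) := by
  have hnn : ∀ m, 0 ≤ a m ⬝ᵥ a m * (b m ⬝ᵥ b m) := fun m =>
    mul_nonneg (dotProduct_self_nonneg _) (dotProduct_self_nonneg _)
  have hmeas : Measurable fun m => a m ⬝ᵥ a m * (b m ⬝ᵥ b m) := by
    simp only [dotProduct]
    fun_prop
  have hint : Integrable (fun m => a m ⬝ᵥ a m * (b m ⬝ᵥ b m)) π := by
    refine (integrable_const (1 : ℝ)).mono' hmeas.aestronglyMeasurable ?_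
    filter_upwards [hab] with m hm
    rwa [Real.norm_eq_abs, abs_of_nonneg (hnn m)]
  have hd0 : 0 ≤ d := (integral_nonneg hnn).trans hd
  have hZ : Measurable fun z : (Fin p → ℝ) × (Fin p → ℝ) =>
      s * ((z.1 ⬝ᵥ a z.2) * (z.1 ⬝ᵥ b z.2)) := by
    simp only [dotProduct]
    fun_prop
  refine integrable_and_lintegral_exp_sub_integral_le hZ (by positivity) ?_
  rw [lintegral_prod_symm' _ (by fun_prop)]
  calc _ ≤ ∫⁻ m, ENNReal.ofReal (16 * (s * κ) ^ 2 * (a m ⬝ᵥ a m * (b m ⬝ᵥ b m))) ∂π := by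
        refine lintegral_mono_ae ?_
        filter_upwards [hab] with m hm
        exact lintegral_sq_mul_exp_dotProduct_le hκ hν hs hm
    _ = ENNReal.ofReal (∫ m, 16 * (s * κ) ^ 2 * (a m ⬝ᵥ a m * (b m ⬝ᵥ b m)) ∂π) :=
        (ofReal_integral_eq_lintegral_ofReal (hint.const_mul _)
          (ae_of_all _ fun m => mul_nonneg (by positivity) (hnn m))).symm
    _ ≤ _ := by
        rw [integral_const_mul]
        gcongr

end OneSample

/-- The first two moments of a mask of independent Bernoulli variables with parameter `δ`. -/
structure IsBernoulliMask {p : ℕ} (π : Measure (Fin p → ℝ)) (δ : ℝ) : Prop where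
  eq_zero_or_one : ∀ᵐ m ∂π, ∀ j, m j = 0 ∨ m j = 1
  integral_eval : ∀ j, ∫ m, m j ∂π = δ
  integral_mul : ∀ j k, j ≠ k → ∫ m, m j * m k ∂π = δ ^ 2

/-- The contribution of one masked observation `m ∘ x` to the quadratic form of the bias-corrected
covariance matrix at `u`. -/
noncomputable def sampleForm {p : ℕ} (δ : ℝ) (u x m : Fin p → ℝ) : ℝ :=
  (δ ^ 2)⁻¹ * ((∑ j, m j * x j * u j) ^ 2 - ∑ j, (m j * x j * u j) ^ 2)
    + δ⁻¹ * ∑ j, (m j * x j * u j) ^ 2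

theorem measurable_sampleForm {p : ℕ} (δ : ℝ) (u : Fin p → ℝ) :
    Measurable fun z : (Fin p → ℝ) × (Fin p → ℝ) => sampleForm δ u z.1 z.2 := by
  unfold sampleForm
  fun_prop

section OneSample

variable {p : ℕ} {ν π : Measure (Fin p → ℝ)} {κ δ : ℝ}

theorem IsBernoulliMask.integrable_mul [IsProbabilityMeasure π] (h : IsBernoulliMask π δ)
    (j k : Fin p) : Integrable (fun m => m j * m k) π := by
  refine (integrable_const (1 : ℝ)).mono' (by fun_prop) ?_
  filter_upwards [h.eq_zero_or_one] with m hm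
  rcases hm j with h₁ | h₁ <;> rcases hm k with h₂ | h₂ <;> simp [h₁, h₂]

theorem IsBernoulliMask.integral_mul_eq (h : IsBernoulliMask π δ) (j k : Fin p) :
    ∫ m, m j * m k ∂π = if j = k then δ else δ ^ 2 := by
  split_ifs with hjk
  · subst hjk
    rw [← h.integral_eval j]
    refine integral_congr_ae ?_
    filter_upwards [h.eq_zero_or_one] with m hm
    rcases hm j with h₁ | h₁ <;> simp [h₁]
  · exact h.integral_mul j k hjk

theorem integrable_mul_of_lintegral_exp_le (hκ : 0 < κ)
    (hν : ∀ v ∈ unitSphere p, ∫⁻ x, ENNReal.ofReal (Real.exp ((x ⬝ᵥ v) ^ 2 / κ)) ∂ν ≤ 2)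
    (j k : Fin p) : Integrable (fun x => x j * x k) ν := by
  have hsq : ∀ j, Integrable (fun x : Fin p → ℝ => κ * Real.exp (x j ^ 2 / κ)) ν := by
    intro j
    refine Integrable.const_mul ⟨(by fun_prop : Measurable _).aestronglyMeasurable, ?_⟩ κ
    rw [hasFiniteIntegral_iff_ofReal (ae_of_all _ fun a => (Real.exp_pos _).le)]
    have h₁ := hν (Pi.single j 1) (by rw [mem_unitSphere_iff]; simp)
    simp only [dotProduct_single_one] at h₁
    exact h₁.trans_lt (by simp)
  refine ((hsq j).add (hsq k)).mono' (by fun_prop) (ae_of_all _ fun x => ?_)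
  have hle : ∀ t : ℝ, t ^ 2 ≤ κ * Real.exp (t ^ 2 / κ) := by
    intro t
    have h₁ := Real.add_one_le_exp (t ^ 2 / κ)
    calc t ^ 2 = κ * (t ^ 2 / κ) := by field_simp
      _ ≤ _ := by gcongr; linarith
  have h₁ := hle (x j)
  have h₂ := hle (x k)
  rw [Real.norm_eq_abs, abs_mul, Pi.add_apply]
  nlinarith [sq_nonneg (|x j| - |x k|), sq_abs (x j), sq_abs (x k), sq_nonneg (x j),
    sq_nonneg (x k)]

theorem sampleForm_eq_sum (u x m : Fin p → ℝ) :
    sampleForm δ u x m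
      = ∑ j, ∑ k, u j * u k * (if j = k then δ⁻¹ else (δ ^ 2)⁻¹) * ((x j * x k) * (m j * m k)) := by
  have h₁ : ∀ j k, u j * u k * (if j = k then δ⁻¹ else (δ ^ 2)⁻¹) * ((x j * x k) * (m j * m k))
      = (δ ^ 2)⁻¹ * ((m j * x j * u j) * (m k * x k * u k))
        + if j = k then (δ⁻¹ - (δ ^ 2)⁻¹) * (m j * x j * u j) ^ 2 else 0 := by
    intro j k
    split_ifs with h
    · subst h; ring
    · ring
  simp only [h₁, Finset.sum_add_distrib, Finset.sum_ite_eq, Finset.mem_univ, if_true]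
  simp only [← Finset.mul_sum, sampleForm, sq (∑ j, m j * x j * u j), Finset.sum_mul_sum]
  ring

/-- Unbiasedness: the weights `δ⁻¹` on the diagonal and `δ⁻²` off it are the inverses of `E[m j * m
k]`. -/
theorem integral_sampleForm [IsProbabilityMeasure ν] [IsProbabilityMeasure π] (hκ : 0 < κ)
    (hν : ∀ v ∈ unitSphere p, ∫⁻ x, ENNReal.ofReal (Real.exp ((x ⬝ᵥ v) ^ 2 / κ)) ∂ν ≤ 2)
    (hδ : 0 < δ) (hπ : IsBernoulliMask π δ) (u : Fin p → ℝ) :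
    ∫ z, sampleForm δ u z.1 z.2 ∂ν.prod π
      = u ⬝ᵥ secondMomentMatrix (fun x : Fin p → ℝ => x) ν *ᵥ u := by
  have hint : ∀ j k, Integrable (fun z : (Fin p → ℝ) × (Fin p → ℝ) =>
      u j * u k * (if j = k then δ⁻¹ else (δ ^ 2)⁻¹) * ((z.1 j * z.1 k) * (z.2 j * z.2 k)))
      (ν.prod π) := fun j k =>
    ((integrable_mul_of_lintegral_exp_le hκ hν j k).mul_prod (hπ.integrable_mul j k)).const_mul _
  simp only [sampleForm_eq_sum]
  rw [integral_finsetSum _ fun j _ => integrable_finsetSum _ fun k _ => hint j k]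
  simp only [dotProduct, Matrix.mulVec, secondMomentMatrix, Matrix.of_apply, Finset.mul_sum]
  refine Finset.sum_congr rfl fun j _ => ?_
  rw [integral_finsetSum _ fun k _ => hint j k]
  refine Finset.sum_congr rfl fun k _ => ?_
  rw [integral_const_mul, integral_prod_mul (fun x : Fin p → ℝ => x j * x k)
    (fun m : Fin p → ℝ => m j * m k), hπ.integral_mul_eq]
  split_ifs <;> field_simp

/-- The blocks are disjoint, so every pair of masks that occurs is a pair with distinct indices and
contributes `δ²`. A diagonal pair would contribute `δ`; avoiding it is the purpose of decoupling. -/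
theorem IsBernoulliMask.integral_block_le [IsProbabilityMeasure π] (hπ : IsBernoulliMask π δ)
    {u : Fin p → ℝ} (hu : u ∈ unitSphere p) (I : Finset (Fin p)) :
    ∫ m, (∑ j ∈ I, (m j * u j) ^ 2) * ∑ k ∈ Iᶜ, (m k * u k) ^ 2 ∂π ≤ δ ^ 2 := by
  have h₁ : ∫ m, (∑ j ∈ I, (m j * u j) ^ 2) * ∑ k ∈ Iᶜ, (m k * u k) ^ 2 ∂π
      = ∫ m, ∑ j ∈ I, ∑ k ∈ Iᶜ, u j ^ 2 * u k ^ 2 * (m j * m k) ∂π := by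
    refine integral_congr_ae ?_
    filter_upwards [hπ.eq_zero_or_one] with m hm
    have hsq : ∀ j, m j ^ 2 = m j := fun j => by rcases hm j with h | h <;> simp [h]
    rw [Finset.sum_mul_sum]
    refine Finset.sum_congr rfl fun j _ => Finset.sum_congr rfl fun k _ => ?_
    rw [mul_pow, mul_pow, hsq, hsq]
    ring
  have h₂ : ∫ m, ∑ j ∈ I, ∑ k ∈ Iᶜ, u j ^ 2 * u k ^ 2 * (m j * m k) ∂π
      = δ ^ 2 * ((∑ j ∈ I, u j ^ 2) * ∑ k ∈ Iᶜ, u k ^ 2) := by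
    have hint : ∀ j k, Integrable (fun m : Fin p → ℝ => u j ^ 2 * u k ^ 2 * (m j * m k)) π :=
      fun j k => (hπ.integrable_mul j k).const_mul _
    rw [integral_finsetSum _ fun j _ => integrable_finsetSum _ fun k _ => hint j k,
      Finset.sum_mul_sum, Finset.mul_sum]
    refine Finset.sum_congr rfl fun j hj => ?_
    rw [integral_finsetSum _ fun k _ => hint j k, Finset.mul_sum]
    refine Finset.sum_congr rfl fun k hk => ?_
    have hjk : j ≠ k := fun h => Finset.mem_compl.1 hk (h ▸ hj)
    rw [integral_const_mul, hπ.integral_mul j k hjk]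
    ring
  have hsum : ∑ j ∈ I, u j ^ 2 + ∑ k ∈ Iᶜ, u k ^ 2 = 1 := by
    rw [Finset.sum_add_sum_compl]
    exact hu
  have hA : 0 ≤ ∑ j ∈ I, u j ^ 2 := by positivity
  have hB : 0 ≤ ∑ k ∈ Iᶜ, u k ^ 2 := by positivity
  rw [h₁, h₂]
  exact mul_le_of_le_one_right (sq_nonneg _) (by nlinarith)

/-- The exponential moments of the centered contribution of one observation. -/
theorem lintegral_exp_sampleForm_le [IsProbabilityMeasure ν] [IsProbabilityMeasure π] (hκ : 0 < κ)
    (hν : ∀ v ∈ unitSphere p, ∫⁻ x, ENNReal.ofReal (Real.exp ((x ⬝ᵥ v) ^ 2 / κ)) ∂ν ≤ 2)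
    (hδ : 0 < δ) (hδ₁ : δ ≤ 1) (hπ : IsBernoulliMask π δ) {u : Fin p → ℝ} (hu : u ∈ unitSphere p)
    {s : ℝ} (hs : |s| * κ ≤ δ ^ 2 / 16) :
    ∫⁻ z, ENNReal.ofReal (Real.exp (s * (sampleForm δ u z.1 z.2
        - u ⬝ᵥ secondMomentMatrix (fun x : Fin p → ℝ => x) ν *ᵥ u))) ∂ν.prod π
      ≤ ENNReal.ofReal (Real.exp (1024 * (s * κ) ^ 2 / δ ^ 2)) := by
  classical
  let a : Finset (Fin p) → (Fin p → ℝ) → Fin p → ℝ := fun I m j =>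
    if j ∈ I then m j * u j else 0
  have hdot : ∀ I (x m : Fin p → ℝ), x ⬝ᵥ a I m = ∑ j ∈ I, m j * x j * u j := by
    intro I x m
    simp only [dotProduct, a, mul_ite, mul_zero, Finset.sum_ite_mem, Finset.univ_inter]
    exact Finset.sum_congr rfl fun j _ => by ring
  have hself : ∀ I (m : Fin p → ℝ), a I m ⬝ᵥ a I m = ∑ j ∈ I, (m j * u j) ^ 2 := by
    intro I m
    rw [hdot]
    exact Finset.sum_congr rfl fun j hj => by simp only [a, hj, if_true]; ring
  have hameas : ∀ I, Measurable (a I) := by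
    intro I
    refine measurable_pi_lambda _ fun j => ?_
    simp only [a]
    split_ifs <;> fun_prop
  have hle1 : ∀ᵐ m ∂π, ∀ I, a I m ⬝ᵥ a I m ≤ 1 := by
    filter_upwards [hπ.eq_zero_or_one] with m hm I
    rw [hself, ← show ∑ j, u j ^ 2 = 1 from hu]
    refine (Finset.sum_le_univ_sum_of_nonneg fun j => sq_nonneg _).trans
      (Finset.sum_le_sum fun j _ => ?_)
    rcases hm j with h | h <;> simp [h, sq_nonneg]
  -- The `8` is the decoupling factor `4` times `2`, the latter because the off-diagonal part
  -- receives half of the weight below. The hypothesis on `s` then gives exactly the threshold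
  -- `1/2`.
  have hoff := fun I => integrable_and_lintegral_exp_mul_dotProduct_le (ν := ν) (π := π)
    (s := 8 * s * (δ ^ 2)⁻¹) hκ hν (by
      rw [abs_mul, abs_mul, abs_of_pos (by positivity : 0 < (δ ^ 2)⁻¹), abs_of_pos (by norm_num)]
      calc 8 * |s| * (δ ^ 2)⁻¹ * κ = 8 * (|s| * κ) * (δ ^ 2)⁻¹ := by ring
        _ ≤ 8 * (δ ^ 2 / 16) * (δ ^ 2)⁻¹ := by gcongr
        _ = 1 / 2 := by field_simp; norm_num) (hameas I) (hameas Iᶜ) (by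
      filter_upwards [hle1] with m hm
      exact mul_le_one₀ (hm I) (dotProduct_self_nonneg _) (hm Iᶜ)) (d := δ ^ 2) (by
      simp only [hself]
      exact hπ.integral_block_le hu I)
  let e : Fin p → (Fin p → ℝ) → Fin p → ℝ := fun j m => Pi.single j (m j)
  have hemeas : ∀ j, Measurable (e j) := by
    intro j
    refine measurable_pi_lambda _ fun k => ?_
    simp only [e, Pi.single_apply]
    split_ifs <;> fun_prop
  have hedot : ∀ j (x m : Fin p → ℝ), x ⬝ᵥ e j m = m j * x j := fun j x m => by
    simp [e, mul_comm]
  have hdiag := fun j => integrable_and_lintegral_exp_mul_dotProduct_le (ν := ν) (π := π)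
    (s := 2 * s * δ⁻¹) hκ hν (by
      rw [abs_mul, abs_mul, abs_of_pos (by positivity : 0 < δ⁻¹), abs_of_pos (by norm_num)]
      calc 2 * |s| * δ⁻¹ * κ = 2 * (|s| * κ) * δ⁻¹ := by ring
        _ ≤ 2 * (δ ^ 2 / 16) * δ⁻¹ := by gcongr
        _ = δ / 8 := by field_simp; norm_num
        _ ≤ 1 / 2 := by linarith) (hemeas j) (hemeas j) (by
      filter_upwards [hπ.eq_zero_or_one] with m hm
      rw [hedot]
      rcases hm j with h | h <;> simp [h, e]) (d := δ) (by
      refine (integral_congr_ae ?_).trans_le (hπ.integral_eval j).le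
      filter_upwards [hπ.eq_zero_or_one] with m hm
      rw [hedot]
      rcases hm j with h | h <;> simp [h, e])
  let Z : Finset (Fin p) ⊕ Fin p → (Fin p → ℝ) × (Fin p → ℝ) → ℝ := Sum.elim
    (fun I z => 8 * s * (δ ^ 2)⁻¹ * ((z.1 ⬝ᵥ a I z.2) * (z.1 ⬝ᵥ a Iᶜ z.2)))
    (fun j z => 2 * s * δ⁻¹ * ((z.1 ⬝ᵥ e j z.2) * (z.1 ⬝ᵥ e j z.2)))
  -- Half of the mass is uniform over the `2 ^ p` splittings, half is spread over the diagonal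
  -- according to `u j ^ 2`.
  let w : Finset (Fin p) ⊕ Fin p → ℝ := Sum.elim (fun _ => (2 * 2 ^ p)⁻¹) (fun j => u j ^ 2 / 2)
  have hZi : ∀ i, Integrable (Z i) (ν.prod π) := by
    rintro (I | j)
    · exact (hoff I).1
    · exact (hdiag j).1
  have hZm : ∀ i, Measurable (Z i) := by
    rintro (I | j)
    · have h₁ := hameas I
      have h₂ := hameas Iᶜ
      simp only [Z, Sum.elim_inl, dotProduct]
      fun_prop
    · have h₁ := hemeas j
      simp only [Z, Sum.elim_inr, dotProduct]
      fun_prop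
  have hdecomp : ∀ z : (Fin p → ℝ) × (Fin p → ℝ),
      s * sampleForm δ u z.1 z.2 = ∑ i, w i * Z i z := by
    intro z
    have h₁ := sum_finset_mul_sum_compl fun j => z.2 j * z.1 j * u j
    rw [Fintype.card_fin] at h₁
    have h₂ : ∑ I : Finset (Fin p), w (Sum.inl I) * Z (Sum.inl I) z
        = s * (δ ^ 2)⁻¹ * (2 ^ p)⁻¹ * ∑ I : Finset (Fin p),
          4 * ((∑ j ∈ I, z.2 j * z.1 j * u j) * ∑ j ∈ Iᶜ, z.2 j * z.1 j * u j) := by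
      rw [Finset.mul_sum]
      refine Finset.sum_congr rfl fun I _ => ?_
      simp only [w, Z, Sum.elim_inl, hdot, mul_inv]
      ring
    have h₃ : ∑ j : Fin p, w (Sum.inr j) * Z (Sum.inr j) z
        = s * δ⁻¹ * ∑ j, (z.2 j * z.1 j * u j) ^ 2 := by
      rw [Finset.mul_sum]
      refine Finset.sum_congr rfl fun j _ => ?_
      simp only [w, Z, Sum.elim_inr, hedot]
      ring
    rw [Fintype.sum_sum_type, h₂, h₃, h₁, sampleForm]
    field_simp
  have hmean : s * (u ⬝ᵥ secondMomentMatrix (fun x : Fin p → ℝ => x) ν *ᵥ u)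
      = ∑ i, w i * ∫ z, Z i z ∂ν.prod π := by
    rw [← integral_sampleForm hκ hν hδ hπ u, ← integral_const_mul]
    simp only [hdecomp]
    rw [integral_finsetSum _ fun i _ => (hZi i).const_mul _]
    simp only [integral_const_mul]
  have hw₁ : ∑ i, w i = 1 := by
    have h₁ : ∑ j, u j ^ 2 = 1 := hu
    rw [Fintype.sum_sum_type]
    simp only [w, Sum.elim_inl, Sum.elim_inr, ← Finset.sum_div, h₁, Finset.sum_const,
      Finset.card_univ, Fintype.card_finset, Fintype.card_fin, nsmul_eq_mul]
    push_cast
    field_simp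
    norm_num
  have hw : ∀ i, 0 ≤ w i := by
    rintro (I | j) <;> simp only [w, Sum.elim_inl, Sum.elim_inr] <;> positivity
  -- The off-diagonal terms give `16 * 8² * δ⁻⁴ * δ² = 1024 / δ²`, the diagonal ones only `64 / δ`.
  have key := lintegral_exp_sum_le (ρ := ν.prod π) hw hw₁
    (Z := fun i z => Z i z - ∫ z', Z i z' ∂ν.prod π) (fun i => (hZm i).sub_const _)
    (B := Real.exp (1024 * (s * κ) ^ 2 / δ ^ 2)) (by
      rintro (I | j)
      · refine (hoff I).2.trans (ENNReal.ofReal_le_ofReal (Real.exp_le_exp.2 (le_of_eq ?_)))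
        field_simp
        ring
      · refine (hdiag j).2.trans (ENNReal.ofReal_le_ofReal (Real.exp_le_exp.2 ?_))
        calc 16 * (2 * s * δ⁻¹ * κ) ^ 2 * δ = 64 * (s * κ) ^ 2 / δ ^ 2 * δ := by
              field_simp; ring
          _ ≤ 64 * (s * κ) ^ 2 / δ ^ 2 * 1 := by gcongr
          _ ≤ 1024 * (s * κ) ^ 2 / δ ^ 2 := by
              rw [mul_one]
              gcongr
              norm_num)
  refine le_of_eq_of_le (lintegral_congr fun z => ?_) key
  rw [mul_sub, hdecomp, hmean, ← Finset.sum_sub_distrib]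
  simp only [mul_sub]

end OneSample

/-! ### Chernoff's bound -/

/-- Chernoff's bound for a sum of i.i.d. random variables on a product space. -/
theorem measure_pi_le_sum_le {α : Type*} [MeasurableSpace α] {ρ : Measure α}
    [IsProbabilityMeasure ρ] {f : α → ℝ} (hf : Measurable f) {a : ℝ}
    (h : ∫⁻ z, ENNReal.ofReal (Real.exp (f z)) ∂ρ ≤ ENNReal.ofReal (Real.exp a)) (n : ℕ) (x : ℝ) :
    Measure.pi (fun _ : Fin n => ρ) {z | x ≤ ∑ i, f (z i)}
      ≤ ENNReal.ofReal (Real.exp (n * a - x)) := by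
  have hprod : ∫⁻ z, ENNReal.ofReal (Real.exp (∑ i, f (z i))) ∂Measure.pi (fun _ : Fin n => ρ)
      ≤ ENNReal.ofReal (Real.exp (n * a)) := by
    have hind : iIndepFun (fun (i : Fin n) (z : Fin n → α) => ENNReal.ofReal (Real.exp (f (z i))))
        (Measure.pi fun _ => ρ) :=
      iIndepFun_pi (X := fun _ z => ENNReal.ofReal (Real.exp (f z))) fun _ => by fun_prop
    have h₁ := lintegral_prod_eq_prod_lintegral_of_indepFun Finset.univ
      (fun (i : Fin n) (z : Fin n → α) => ENNReal.ofReal (Real.exp (f (z i)))) hind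
      fun i => by fun_prop
    have h₂ : ∀ i : Fin n, ∫⁻ z, ENNReal.ofReal (Real.exp (f (z i))) ∂Measure.pi (fun _ => ρ)
        = ∫⁻ z, ENNReal.ofReal (Real.exp (f z)) ∂ρ := fun i =>
      (measurePreserving_eval (fun _ : Fin n => ρ) i).lintegral_comp
        (f := fun z => ENNReal.ofReal (Real.exp (f z))) (by fun_prop)
    calc _ = ∫⁻ z, ∏ i, ENNReal.ofReal (Real.exp (f (z i))) ∂Measure.pi (fun _ : Fin n => ρ) := by
          refine lintegral_congr fun z => ?_
          rw [Real.exp_sum, ENNReal.ofReal_prod_of_nonneg fun i _ => (Real.exp_pos _).le]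
      _ = ∏ _i : Fin n, ∫⁻ z, ENNReal.ofReal (Real.exp (f z)) ∂ρ := by
          rw [h₁, Finset.prod_congr rfl fun i _ => h₂ i]
      _ ≤ ∏ _i : Fin n, ENNReal.ofReal (Real.exp a) := Finset.prod_le_prod' fun i _ => h
      _ = _ := by
          rw [Finset.prod_const, Finset.card_univ, Fintype.card_fin,
            ← ENNReal.ofReal_pow (Real.exp_pos _).le, ← Real.exp_nat_mul]
  calc Measure.pi (fun _ : Fin n => ρ) {z | x ≤ ∑ i, f (z i)}
      ≤ Measure.pi (fun _ : Fin n => ρ)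
        {z | ENNReal.ofReal (Real.exp x) ≤ ENNReal.ofReal (Real.exp (∑ i, f (z i)))} :=
        measure_mono fun z (hz : x ≤ _) => ENNReal.ofReal_le_ofReal (Real.exp_le_exp.2 hz)
    _ ≤ (∫⁻ z, ENNReal.ofReal (Real.exp (∑ i, f (z i))) ∂Measure.pi (fun _ : Fin n => ρ))
        / ENNReal.ofReal (Real.exp x) :=
        meas_ge_le_lintegral_div (by fun_prop : Measurable _).aemeasurable
          (by simp [Real.exp_pos]) ENNReal.ofReal_ne_top
    _ ≤ ENNReal.ofReal (Real.exp (n * a)) / ENNReal.ofReal (Real.exp x) := by gcongr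
    _ = _ := by
        rw [← ENNReal.ofReal_div_of_pos (Real.exp_pos _), Real.exp_sub]

/-! ### Entropy of sparse supports -/

/-- Entropy of the supports of size `k`, plus the confidence level. -/
noncomputable def sparseEntropy (p k : ℕ) : ℝ :=
  k * Real.log (Real.exp 1 * p / k) + Real.log (Real.exp 1 * p)

theorem one_le_log_exp_one_mul_div {p s : ℝ} (hs : 0 < s) (hsp : s ≤ p) :
    1 ≤ Real.log (Real.exp 1 * p / s) := by
  rw [Real.le_log_iff_exp_le (div_pos (mul_pos (Real.exp_pos 1) (hs.trans_le hsp)) hs),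
    le_div_iff₀ hs]
  gcongr

/-- Monotonicity of `t * log (e p / t)` up to `t = p`, where the logarithm is still at least `1`. -/
theorem mul_log_div_le_of_le {p k s : ℝ} (hk : 0 < k) (hks : k ≤ s) (hsp : s ≤ p) :
    k * Real.log (Real.exp 1 * p / k) ≤ s * Real.log (Real.exp 1 * p / s) := by
  have hs : 0 < s := hk.trans_le hks
  have hp : 0 < p := hs.trans_le hsp
  have hL := one_le_log_exp_one_mul_div hs hsp
  have h₁ : Real.log (Real.exp 1 * p / k) = Real.log (Real.exp 1 * p / s) + Real.log (s / k) := by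
    rw [← Real.log_mul (by positivity) (by positivity)]
    congr 1
    field_simp
  have h₂ : k * Real.log (s / k) ≤ s - k := by
    calc k * Real.log (s / k) ≤ k * (s / k - 1) := by
          gcongr
          exact Real.log_le_sub_one_of_pos (by positivity)
      _ = s - k := by field_simp
  rw [h₁]
  nlinarith

theorem sparseEntropy_nonneg {p k : ℕ} (hk : 1 ≤ k) (hkp : k ≤ p) : 0 ≤ sparseEntropy p k := by
  have hk' : (0 : ℝ) < k := by exact_mod_cast hk
  have hkp' : (k : ℝ) ≤ p := by exact_mod_cast hkp
  have h₁ := one_le_log_exp_one_mul_div hk' hkp'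
  have h₂ := one_le_log_exp_one_mul_div one_pos (show (1 : ℝ) ≤ p by exact_mod_cast hk.trans hkp)
  rw [div_one] at h₂
  unfold sparseEntropy
  positivity

theorem sparseEntropy_le {p k : ℕ} (hk : 1 ≤ k) (hkp : k ≤ p) :
    sparseEntropy p k ≤ 2 * k * Real.log (Real.exp 1 * p) := by
  have hk' : (1 : ℝ) ≤ k := by exact_mod_cast hk
  have hkp' : (k : ℝ) ≤ p := by exact_mod_cast hkp
  have hp : (0 : ℝ) < p := by linarith
  have h₂ := one_le_log_exp_one_mul_div one_pos (hk'.trans hkp')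
  rw [div_one] at h₂
  have h₃ : Real.log (Real.exp 1 * p / k) ≤ Real.log (Real.exp 1 * p) :=
    Real.log_le_log (by positivity) (div_le_self (by positivity) hk')
  unfold sparseEntropy
  nlinarith

/-- Joint supports have up to `2 * s` elements. Their entropy costs two units of `s * log (e p / s)`
and the confidence level one; hence the range `t ≤ 3 * (δ ^ 2 * n)` required in the deviation bound.
-/
theorem sparseEntropy_le_of_le_two_mul {p k : ℕ} {s : ℝ} (hs : 1 ≤ s) (hsp : s ≤ p) (hk : 1 ≤ k)
    (hkp : k ≤ p) (hks : (k : ℝ) ≤ 2 * s) :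
    sparseEntropy p k ≤ 3 * (s * Real.log (Real.exp 1 * p / s)) := by
  have hk' : (0 : ℝ) < k := by exact_mod_cast hk
  have hkp' : (k : ℝ) ≤ p := by exact_mod_cast hkp
  have hp : (0 : ℝ) < p := by linarith
  have hL := one_le_log_exp_one_mul_div (by linarith) hsp
  have h₁ := mul_log_div_le_of_le one_pos hs hsp
  rw [one_mul, div_one] at h₁
  have h₂ : k * Real.log (Real.exp 1 * p / k) ≤ 2 * (s * Real.log (Real.exp 1 * p / s)) := by
    rcases le_total (k : ℝ) s with h | h
    · have := mul_log_div_le_of_le hk' h hsp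
      nlinarith
    · have h₃ : Real.log (Real.exp 1 * p / k) ≤ Real.log (Real.exp 1 * p / s) := by
        gcongr
      calc k * Real.log (Real.exp 1 * p / k) ≤ k * Real.log (Real.exp 1 * p / s) := by gcongr
        _ ≤ 2 * s * Real.log (Real.exp 1 * p / s) := by gcongr
        _ = _ := by ring
  unfold sparseEntropy
  linarith

/-- Of the five copies of `k * log (e p / k)` in the exponent, one pays for the choice of the
support and three for the net. The five copies of `log (e p)` leave more than the `p⁻²` needed to
sum over `k`. -/
theorem choose_mul_nine_pow_mul_exp_le {p k : ℕ} (hk : 1 ≤ k) (hkp : k ≤ p) :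
    (p.choose k : ℝ) * (9 ^ k * (2 * Real.exp (-(5 * sparseEntropy p k)))) ≤ 1 / (p : ℝ) ^ 2 := by
  have hk' : (0 : ℝ) < k := by exact_mod_cast hk
  have hkp' : (k : ℝ) ≤ p := by exact_mod_cast hkp
  have hp1 : (1 : ℝ) ≤ p := by exact_mod_cast hk.trans hkp
  have hp : (0 : ℝ) < p := by linarith
  set L := Real.log (Real.exp 1 * p / k) with hL
  have hL1 : 1 ≤ L := one_le_log_exp_one_mul_div hk' hkp'
  have hchoose : (p.choose k : ℝ) ≤ Real.exp (k * L) := by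
    have h₁ : (k : ℝ) ^ k / (k.factorial : ℝ) ≤ Real.exp k :=
      Real.pow_div_factorial_le_exp _ hk'.le _
    have h₂ : Real.exp (k * L) = (p : ℝ) ^ k * Real.exp k / (k : ℝ) ^ k := by
      rw [Real.exp_nat_mul, hL, Real.exp_log (by positivity), div_pow, mul_pow,
        ← Real.exp_nat_mul, mul_one]
      ring
    have h₃ : (p.choose k : ℝ) ≤ (p : ℝ) ^ k / k.factorial := Nat.choose_le_pow_div k p
    rw [h₂, le_div_iff₀ (by positivity)]
    calc (p.choose k : ℝ) * (k : ℝ) ^ k ≤ (p : ℝ) ^ k / k.factorial * (k : ℝ) ^ k := by gcongr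
      _ = (p : ℝ) ^ k * ((k : ℝ) ^ k / k.factorial) := by ring
      _ ≤ _ := by gcongr
  have hnine : (9 : ℝ) ^ k ≤ Real.exp (3 * (k * L)) := by
    have h₁ : (9 : ℝ) ≤ Real.exp 3 := by
      have h₂ : Real.exp 3 = Real.exp 1 ^ 3 := by rw [← Real.exp_nat_mul]; norm_num
      rw [h₂]
      have h₃ := Real.exp_one_gt_d9
      calc (9 : ℝ) ≤ 2.7 ^ 3 := by norm_num
        _ ≤ Real.exp 1 ^ 3 := by gcongr; linarith
    calc (9 : ℝ) ^ k ≤ Real.exp 3 ^ k := by gcongr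
      _ = Real.exp (3 * k) := by rw [← Real.exp_nat_mul, mul_comm]
      _ ≤ _ := Real.exp_le_exp.2 (by nlinarith)
  have hexp : (2 : ℝ) * Real.exp (-(5 * Real.log (Real.exp 1 * p))) ≤ 1 / (p : ℝ) ^ 2 := by
    have h₁ : Real.exp (-(5 * Real.log (Real.exp 1 * p))) = ((Real.exp 1 * p) ^ 5)⁻¹ := by
      rw [Real.exp_neg, show (5 : ℝ) = ((5 : ℕ) : ℝ) by norm_num, Real.exp_nat_mul,
        Real.exp_log (by positivity)]
    have h₂ : (2 : ℝ) ≤ Real.exp 1 ^ 5 := by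
      have h₃ := Real.add_one_le_exp (1 : ℝ)
      calc (2 : ℝ) ≤ 2 ^ 5 := by norm_num
        _ ≤ _ := by gcongr; linarith
    rw [h₁, ← div_eq_mul_inv, div_le_div_iff₀ (by positivity) (by positivity), one_mul, mul_pow]
    have h₄ : (p : ℝ) ^ 2 ≤ (p : ℝ) ^ 5 := pow_le_pow_right₀ hp1 (by norm_num)
    gcongr
  calc (p.choose k : ℝ) * (9 ^ k * (2 * Real.exp (-(5 * sparseEntropy p k))))
      ≤ Real.exp (k * L) * (Real.exp (3 * (k * L)) *
        (2 * Real.exp (-(5 * sparseEntropy p k)))) := by gcongr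
    _ = 2 * Real.exp (-(k * L) + -(5 * Real.log (Real.exp 1 * p))) := by
        have : Real.exp (k * L) * (Real.exp (3 * (k * L)) *
            (2 * Real.exp (-(5 * sparseEntropy p k)))) = 2 * (Real.exp (k * L) *
            Real.exp (3 * (k * L)) * Real.exp (-(5 * sparseEntropy p k))) := by ring
        rw [this, ← Real.exp_add, ← Real.exp_add, sparseEntropy, ← hL]
        ring_nf
    _ ≤ 2 * Real.exp (-(5 * Real.log (Real.exp 1 * p))) := by
        gcongr
        have : 0 ≤ k * L := by positivity
        linarith
    _ ≤ _ := hexp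

theorem sum_finset_nine_pow_mul_exp_le {p : ℕ} (hp : 1 ≤ p) :
    ∑ J : Finset (Fin p), (if J.card = 0 then 0 else
      9 ^ J.card * (2 * Real.exp (-(5 * sparseEntropy p J.card)))) ≤ 1 / (p : ℝ) := by
  have hp' : (0 : ℝ) < p := by exact_mod_cast hp
  let g : ℕ → ℝ := fun k => if k = 0 then 0 else
    9 ^ k * (2 * Real.exp (-(5 * sparseEntropy p k)))
  have h := Finset.sum_powerset_apply_card g (x := (Finset.univ : Finset (Fin p)))
  rw [Finset.powerset_univ, Finset.card_univ, Fintype.card_fin] at h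
  change ∑ J : Finset (Fin p), g J.card ≤ _
  rw [h, Finset.sum_range_succ']
  calc _ ≤ ∑ _k ∈ Finset.range p, 1 / (p : ℝ) ^ 2 + 0 := by
        gcongr with k hk
        · simp only [g, Nat.add_eq_zero_iff, one_ne_zero, and_false, if_false, nsmul_eq_mul]
          exact choose_mul_nine_pow_mul_exp_le (by omega) (by have := Finset.mem_range.1 hk; omega)
        · simp [g]
    _ = 1 / (p : ℝ) := by
        rw [Finset.sum_const, Finset.card_range, nsmul_eq_mul]
        field_simp
        ring

/-! ### Uniform deviations over supports and nets -/

section Concentration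

variable {p : ℕ} {ν π : Measure (Fin p → ℝ)} {κ δ : ℝ}

theorem measure_abs_sum_sampleForm_le [IsProbabilityMeasure ν] [IsProbabilityMeasure π]
    (hκ : 0 < κ)
    (hν : ∀ v ∈ unitSphere p, ∫⁻ x, ENNReal.ofReal (Real.exp ((x ⬝ᵥ v) ^ 2 / κ)) ∂ν ≤ 2)
    (hδ : 0 < δ) (hδ₁ : δ ≤ 1) (hπ : IsBernoulliMask π δ) {u : Fin p → ℝ} (hu : u ∈ unitSphere p)
    {n : ℕ} (hn : 0 < n) {t : ℝ} (ht₀ : 0 ≤ t) (ht : t ≤ 3 * (δ ^ 2 * n)) :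
    Measure.pi (fun _ : Fin n => ν.prod π) {z | n * (192 * (κ / δ) * √(t / n)) ≤
      |∑ i, (sampleForm δ u (z i).1 (z i).2
        - u ⬝ᵥ secondMomentMatrix (fun x : Fin p → ℝ => x) ν *ᵥ u)|}
      ≤ ENNReal.ofReal (2 * Real.exp (-(5 * t))) := by
  have hn' : (0 : ℝ) < n := by exact_mod_cast hn
  set c := u ⬝ᵥ secondMomentMatrix (fun x : Fin p → ℝ => x) ν *ᵥ u
  -- This choice makes the log-moment `t / n` per observation and the level `6 * t`, leaving `5 * t`
  -- in the exponent. The bound on `t` gives `√(t / n) ≤ 2 * δ`, hence the admissibility of `s`.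
  set s := δ / κ * √(t / n) / 32 with hs
  have hs₀ : 0 ≤ s := by positivity
  have hsκ : s * κ = δ * √(t / n) / 32 := by
    rw [hs]
    field_simp
  have hroot : √(t / n) ≤ 2 * δ := by
    rw [Real.sqrt_le_left (by positivity), div_le_iff₀ hn']
    nlinarith [mul_pos (pow_pos hδ 2) hn']
  have hsmall : |s| * κ ≤ δ ^ 2 / 16 := by
    rw [abs_of_nonneg hs₀, hsκ]
    nlinarith
  have hvar : 1024 * (s * κ) ^ 2 / δ ^ 2 = t / n := by
    rw [hsκ, div_pow, mul_pow, Real.sq_sqrt (by positivity)]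
    field_simp
    ring
  have hlevel : s * (n * (192 * (κ / δ) * √(t / n))) = 6 * t := by
    have h₁ : √(t / n) * √(t / n) = t / n := Real.mul_self_sqrt (by positivity)
    calc s * (n * (192 * (κ / δ) * √(t / n)))
        = 6 * (δ / κ * (κ / δ)) * n * (√(t / n) * √(t / n)) := by rw [hs]; ring
      _ = 6 * t := by
          rw [h₁]
          field_simp
  have hside : ∀ r : ℝ, r ^ 2 = s ^ 2 → |r| = |s| →
      Measure.pi (fun _ : Fin n => ν.prod π)
        {z | 6 * t ≤ ∑ i, r * (sampleForm δ u (z i).1 (z i).2 - c)}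
        ≤ ENNReal.ofReal (Real.exp (-(5 * t))) := by
    intro r hr hr'
    have h₁ := lintegral_exp_sampleForm_le hκ hν hδ hδ₁ hπ hu (s := r) (by rwa [hr'])
    rw [show 1024 * (r * κ) ^ 2 / δ ^ 2 = t / n by rw [← hvar, mul_pow, mul_pow, hr]] at h₁
    have hm := measurable_sampleForm δ u
    refine (measure_pi_le_sum_le (by fun_prop) h₁ n (6 * t)).trans_eq ?_
    congr 2
    field_simp
    ring
  calc _ ≤ Measure.pi (fun _ : Fin n => ν.prod π)
        ({z | 6 * t ≤ ∑ i, s * (sampleForm δ u (z i).1 (z i).2 - c)} ∪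
          {z | 6 * t ≤ ∑ i, -s * (sampleForm δ u (z i).1 (z i).2 - c)}) := by
        refine measure_mono fun z hz => ?_
        simp only [Set.mem_ofPred_eq, Set.mem_union, ← Finset.mul_sum] at hz ⊢
        have h₁ := mul_le_mul_of_nonneg_left hz hs₀
        rw [hlevel] at h₁
        rcases abs_choice (∑ i, (sampleForm δ u (z i).1 (z i).2 - c)) with h | h
        · left; rwa [h] at h₁
        · right; rw [h] at h₁; linarith
    _ ≤ ENNReal.ofReal (Real.exp (-(5 * t))) + ENNReal.ofReal (Real.exp (-(5 * t))) :=
        (measure_union_le _ _).trans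
          (add_le_add (hside s rfl rfl) (hside (-s) (neg_sq s) (abs_neg s)))
    _ = _ := by
        rw [← ENNReal.ofReal_add (Real.exp_pos _).le (Real.exp_pos _).le]
        ring_nf

/-- Uniform deviation bound over finite families of directions indexed by the supports of size at
most `2 * sbar`. -/
theorem measure_exists_support_le [IsProbabilityMeasure ν] [IsProbabilityMeasure π]
    (hκ : 0 < κ)
    (hν : ∀ v ∈ unitSphere p, ∫⁻ x, ENNReal.ofReal (Real.exp ((x ⬝ᵥ v) ^ 2 / κ)) ∂ν ≤ 2)
    (hδ : 0 < δ) (hδ₁ : δ ≤ 1) (hπ : IsBernoulliMask π δ) {n : ℕ} {sbar : ℝ} (hs : 1 ≤ sbar)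
    (hsp : sbar ≤ p) (hn : (δ ^ 2)⁻¹ * (sbar + 1) * Real.log (Real.exp 1 * p / sbar) ≤ n)
    {N : Finset (Fin p) → Finset (Fin p → ℝ)} (hcard : ∀ J, (N J).card ≤ 9 ^ J.card)
    (hunit : ∀ J, ∀ v ∈ N J, v ∈ unitSphere p) :
    Measure.pi (fun _ : Fin n => ν.prod π) {z | ∃ J : Finset (Fin p), J.card ≠ 0 ∧
      (J.card : ℝ) ≤ 2 * sbar ∧ ∃ v ∈ N J,
        n * (192 * (κ / δ) * √(sparseEntropy p J.card / n)) ≤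
          |∑ i, (sampleForm δ v (z i).1 (z i).2
            - v ⬝ᵥ secondMomentMatrix (fun x : Fin p → ℝ => x) ν *ᵥ v)|}
      ≤ ENNReal.ofReal (1 / p) := by
  classical
  have hp1 : (1 : ℝ) ≤ p := hs.trans hsp
  have hL := one_le_log_exp_one_mul_div (by linarith) hsp
  have hscale : (sbar + 1) * Real.log (Real.exp 1 * p / sbar) ≤ δ ^ 2 * n := by
    rw [mul_assoc, inv_mul_le_iff₀ (by positivity)] at hn
    exact hn
  have hn0 : 0 < n := by
    by_contra! h
    obtain rfl : n = 0 := by omega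
    simp only [CharP.cast_eq_zero, mul_zero] at hscale
    nlinarith
  set bad : (Fin p → ℝ) → ℝ → Set (Fin n → (Fin p → ℝ) × (Fin p → ℝ)) := fun v t =>
    {z | n * (192 * (κ / δ) * √(t / n)) ≤ |∑ i, (sampleForm δ v (z i).1 (z i).2
      - v ⬝ᵥ secondMomentMatrix (fun x : Fin p → ℝ => x) ν *ᵥ v)|} with hbad
  set F : Finset (Finset (Fin p)) :=
    Finset.univ.filter fun J => J.card ≠ 0 ∧ (J.card : ℝ) ≤ 2 * sbar with hF
  calc _ ≤ Measure.pi (fun _ : Fin n => ν.prod π)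
        (⋃ J ∈ F, ⋃ v ∈ N J, bad v (sparseEntropy p J.card)) := by
        refine measure_mono ?_
        rintro z ⟨J, h0, h2, v, hv, hz⟩
        simp only [Set.mem_iUnion]
        exact ⟨J, by simp only [hF, Finset.mem_filter, Finset.mem_univ, true_and]; exact ⟨h0, h2⟩,
          v, hv, hz⟩
    _ ≤ ∑ J ∈ F, ∑ v ∈ N J, Measure.pi (fun _ : Fin n => ν.prod π)
        (bad v (sparseEntropy p J.card)) :=
        (measure_biUnion_finset_le _ _).trans
          (Finset.sum_le_sum fun J _ => measure_biUnion_finset_le _ _)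
    _ ≤ ∑ J ∈ F, ENNReal.ofReal (if J.card = 0 then 0 else
        9 ^ J.card * (2 * Real.exp (-(5 * sparseEntropy p J.card)))) := by
        refine Finset.sum_le_sum fun J hJ => ?_
        simp only [hF, Finset.mem_filter, Finset.mem_univ, true_and] at hJ
        have hJp : J.card ≤ p := by simpa using J.card_le_univ
        have h1J : 1 ≤ J.card := by omega
        have ht : sparseEntropy p J.card ≤ 3 * (δ ^ 2 * n) := by
          refine (sparseEntropy_le_of_le_two_mul hs hsp h1J hJp hJ.2).trans ?_
          nlinarith
        rw [if_neg hJ.1]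
        calc _ ≤ ∑ v ∈ N J, ENNReal.ofReal (2 * Real.exp (-(5 * sparseEntropy p J.card))) :=
              Finset.sum_le_sum fun v hv => measure_abs_sum_sampleForm_le hκ hν hδ hδ₁ hπ
                (hunit J v hv) hn0 (sparseEntropy_nonneg h1J hJp) ht
          _ = ENNReal.ofReal ((N J).card * (2 * Real.exp (-(5 * sparseEntropy p J.card)))) := by
              rw [Finset.sum_const, nsmul_eq_mul, ENNReal.ofReal_mul (Nat.cast_nonneg _),
                ENNReal.ofReal_natCast]
          _ ≤ _ := by
              gcongr
              exact_mod_cast hcard J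
    _ ≤ ∑ J : Finset (Fin p), ENNReal.ofReal (if J.card = 0 then 0 else
        9 ^ J.card * (2 * Real.exp (-(5 * sparseEntropy p J.card)))) :=
        Finset.sum_le_univ_sum_of_nonneg fun _ => zero_le
    _ = ENNReal.ofReal (∑ J : Finset (Fin p), (if J.card = 0 then 0 else
        9 ^ J.card * (2 * Real.exp (-(5 * sparseEntropy p J.card))))) :=
        (ENNReal.ofReal_sum_of_nonneg fun J _ => by split_ifs <;> positivity).symm
    _ ≤ _ := ENNReal.ofReal_le_ofReal (sum_finset_nine_pow_mul_exp_le (by exact_mod_cast hp1))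

end Concentration

/-! ### Laws of the data and of the masks -/

section Laws

theorem lintegral_exp_le_two_of_psi2Norm_lt {Ω : Type*} [MeasurableSpace Ω] {μ : Measure Ω}
    {V : Ω → ℝ} {K : ℝ} (h : psi2Norm V μ < ENNReal.ofReal K) :
    ∫⁻ ω, ENNReal.ofReal (Real.exp (V ω ^ 2 / K ^ 2)) ∂μ ≤ 2 := by
  simp only [psi2Norm, iInf_lt_iff] at h
  obtain ⟨u, ⟨hu, hle⟩, huK⟩ := h
  have huK' : u < K := (ENNReal.ofReal_lt_ofReal_iff_of_nonneg hu.le).1 huK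
  refine (lintegral_mono fun ω => ?_).trans hle
  rw [sq_abs]
  gcongr

theorem secondMomentMatrix_map {Ω : Type*} [MeasurableSpace Ω] {p : ℕ} {μ : Measure Ω}
    {X : Ω → Fin p → ℝ} (hX : AEMeasurable X μ) :
    secondMomentMatrix (fun x : Fin p → ℝ => x) (μ.map X) = secondMomentMatrix X μ := by
  ext j k
  simp only [secondMomentMatrix, Matrix.of_apply]
  rw [integral_map hX (by fun_prop)]

theorem lintegral_dotProduct_sq_eq {p : ℕ} {ν : Measure (Fin p → ℝ)}
    (hint : ∀ j k, Integrable (fun x : Fin p → ℝ => x j * x k) ν) (u : Fin p → ℝ) :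
    ∫⁻ x, ENNReal.ofReal ((x ⬝ᵥ u) ^ 2) ∂ν
      = ENNReal.ofReal (u ⬝ᵥ secondMomentMatrix (fun x : Fin p → ℝ => x) ν *ᵥ u) := by
  have hexp : ∀ x : Fin p → ℝ, (x ⬝ᵥ u) ^ 2 = ∑ j, ∑ k, u j * u k * (x j * x k) := by
    intro x
    rw [sq, dotProduct, Finset.sum_mul_sum]
    exact Finset.sum_congr rfl fun j _ => Finset.sum_congr rfl fun k _ => by ring
  have hi : ∀ j k, Integrable (fun x : Fin p → ℝ => u j * u k * (x j * x k)) ν := fun j k =>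
    (hint j k).const_mul _
  have hsum : Integrable (fun x : Fin p → ℝ => (x ⬝ᵥ u) ^ 2) ν := by
    simp only [hexp]
    exact integrable_finsetSum _ fun j _ => integrable_finsetSum _ fun k _ => hi j k
  rw [← ofReal_integral_eq_lintegral_ofReal hsum (ae_of_all _ fun x => sq_nonneg _)]
  congr 1
  simp only [hexp]
  rw [integral_finsetSum _ fun j _ => integrable_finsetSum _ fun k _ => hi j k]
  simp only [dotProduct, Matrix.mulVec, secondMomentMatrix, Matrix.of_apply, Finset.mul_sum]
  refine Finset.sum_congr rfl fun j _ => ?_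
  rw [integral_finsetSum _ fun k _ => hi j k]
  refine Finset.sum_congr rfl fun k _ => ?_
  rw [integral_const_mul]
  ring

/-- Sub-Gaussian observations whose covariance matrix has spectral norm at most `σ₁` have uniformly
bounded squared-exponential moments. -/
theorem SubGaussianObservations.lintegral_exp_le {Ω : Type*} [MeasurableSpace Ω] {p : ℕ}
    {μ : Measure Ω} {X : Ω → Fin p → ℝ} {c₁ σ₁ σ₂ : ℝ} {θ₁ : Fin p → ℝ} (hc₁ : 0 < c₁)
    (hX : AEMeasurable X μ) (h : SubGaussianObservations c₁ X μ)
    (hcov : IsSpikedCovariance (secondMomentMatrix X μ) σ₁ σ₂ θ₁) {v : Fin p → ℝ}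
    (hv : v ∈ unitSphere p) :
    ∫⁻ x, ENNReal.ofReal (Real.exp ((x ⬝ᵥ v) ^ 2 / (2 * σ₁ / c₁))) ∂μ.map X ≤ 2 := by
  have hσ₁ : 0 < σ₁ := hcov.1.trans_lt hcov.2.1
  have htransfer : ∀ (K : ℝ) (v : Fin p → ℝ),
      psi2Norm (fun ω => X ω ⬝ᵥ v) μ < ENNReal.ofReal K →
      ∫⁻ x, ENNReal.ofReal (Real.exp ((x ⬝ᵥ v) ^ 2 / K ^ 2)) ∂μ.map X ≤ 2 := by
    intro K v hK
    rw [lintegral_map' (by simp only [dotProduct]; exact Measurable.aemeasurable (by fun_prop)) hX]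
    exact lintegral_exp_le_two_of_psi2Norm_lt hK
  -- Finiteness of the `ψ₂`-norm enters only qualitatively: products of coordinates become
  -- integrable, so the second moment matrix has genuine moments as entries.
  obtain ⟨K, hK⟩ := ENNReal.lt_iff_exists_nnreal_btwn.1 h.1
  have hK0 : (0 : ℝ) < K := by
    have := (zero_le.trans_lt hK.1 : (0 : ℝ≥0∞) < K)
    exact_mod_cast this
  have hint := integrable_mul_of_lintegral_exp_le (ν := μ.map X) (κ := (K : ℝ) ^ 2)
    (by positivity) fun v hv => htransfer K v (by
      rw [ENNReal.ofReal_coe_nnreal]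
      exact (le_iSup₂ (f := fun u (_ : u ∈ unitSphere p) => psi2Norm (fun ω => X ω ⬝ᵥ u) μ)
        v hv).trans_lt hK.1)
  have hsecond : ∫⁻ ω, ENNReal.ofReal ((X ω ⬝ᵥ v) ^ 2) ∂μ ≤ ENNReal.ofReal σ₁ := by
    have h₁ := lintegral_dotProduct_sq_eq hint v
    rw [lintegral_map' (by simp only [dotProduct]; exact Measurable.aemeasurable (by fun_prop)) hX,
      secondMomentMatrix_map hX] at h₁
    rw [h₁]
    apply ENNReal.ofReal_le_ofReal
    have h₂ := hcov.quadraticForm_le hv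
    have h₃ := one_sub_dotProduct_sq_nonneg hv hcov.2.2.1
    have h₄ := hcov.2.1
    nlinarith
  -- The squared `ψ₂`-norm is at most `σ₁ / c₁`. The factor `2` makes the comparison strict, so the
  -- infimum need not be attained.
  have hκ : 2 * σ₁ / c₁ = √(2 * σ₁ / c₁) ^ 2 := (Real.sq_sqrt (by positivity)).symm
  rw [hκ]
  refine htransfer _ _ ?_
  have h₁ : ENNReal.ofReal c₁ * psi2Norm (fun ω => X ω ⬝ᵥ v) μ ^ 2 ≤ ENNReal.ofReal σ₁ :=
    (h.2 v).trans hsecond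
  by_contra! hcon
  have h₂ : ENNReal.ofReal c₁ * ENNReal.ofReal √(2 * σ₁ / c₁) ^ 2 ≤ ENNReal.ofReal σ₁ :=
    le_trans (by gcongr) h₁
  rw [← ENNReal.ofReal_pow (by positivity), ← hκ, ← ENNReal.ofReal_mul hc₁.le,
    ENNReal.ofReal_le_ofReal_iff hσ₁.le, mul_div_cancel₀ _ hc₁.ne'] at h₂
  linarith

theorem isBernoulliMask_pi_bernoulliMeasure (p : ℕ) {δ : ℝ} (hδ₀ : 0 ≤ δ) (hδ₁ : δ ≤ 1) :
    IsBernoulliMask (Measure.pi fun _ : Fin p => bernoulliMeasure (1 : ℝ) 0 ⟨δ, hδ₀, hδ₁⟩) δ := by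
  set β := bernoulliMeasure (1 : ℝ) 0 ⟨δ, hδ₀, hδ₁⟩ with hβ
  have hmean : ∫ x, x ∂β = δ := by
    rw [hβ, integral_bernoulliMeasure]
    simp
  have heval : ∀ j : Fin p, ∫ m, m j ∂(Measure.pi fun _ : Fin p => β) = δ := by
    intro j
    rw [← hmean]
    exact integral_comp_eval (μ := fun _ : Fin p => β) (i := j) (f := fun x : ℝ => x) (by fun_prop)
  refine ⟨?_, heval, fun j k hjk => ?_⟩
  · rw [ae_all_iff]
    intro j
    have hae : ∀ᵐ x ∂β, x = 0 ∨ x = 1 := by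
      have hset : MeasurableSet {x : ℝ | ¬(x = 0 ∨ x = 1)} := by measurability
      rw [ae_iff, hβ]
      exact bernoulliMeasure_apply_of_notMem_of_notMem _ hset (by simp) (by simp)
    exact (measurePreserving_eval (fun _ : Fin p => β) j).quasiMeasurePreserving.ae hae
  · have hind : iIndepFun (fun (j : Fin p) (m : Fin p → ℝ) => m j) (Measure.pi fun _ => β) :=
      iIndepFun_pi (X := fun _ x => x) fun _ => by fun_prop
    rw [(hind.indepFun hjk).integral_fun_mul_eq_mul_integral
      (measurable_pi_apply j).aestronglyMeasurable (measurable_pi_apply k).aestronglyMeasurable,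
      heval, heval, sq]

theorem measurePreserving_curry_pi {n p : ℕ} (β : Measure ℝ) [IsProbabilityMeasure β] :
    MeasurePreserving (fun (f : Fin n × Fin p → ℝ) i j => f (i, j))
      (Measure.pi fun _ => β) (Measure.pi fun _ => Measure.pi fun _ => β) := by
  have h : MeasurePreserving (MeasurableEquiv.curry (Fin n) (Fin p) ℝ).symm
      (Measure.pi fun _ => Measure.pi fun _ => β) (Measure.pi fun _ => β) := by
    refine ⟨MeasurableEquiv.measurable _, ?_⟩
    symm
    refine Measure.pi_eq fun s hs => ?_
    rw [MeasurableEquiv.map_apply]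
    have hpre : (MeasurableEquiv.curry (Fin n) (Fin p) ℝ).symm ⁻¹' Set.univ.pi s
        = Set.univ.pi fun i => Set.univ.pi fun j => s (i, j) := by
      ext f
      simp only [Set.mem_preimage, Set.mem_univ_pi, Prod.forall]
      rfl
    rw [hpre, Measure.pi_pi]
    simp only [Measure.pi_pi]
    rw [Fintype.prod_prod_type]
  exact h.symm

/-- Transfers the problem to a product of `n` copies of (data, mask), where Fubini's theorem and
Chernoff's bound apply. -/
theorem hasLaw_sample {Ω : Type*} [MeasurableSpace Ω] {μ : Measure Ω} [IsProbabilityMeasure μ]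
    {n p : ℕ} {ν : Measure (Fin p → ℝ)} [IsProbabilityMeasure ν] {β : Measure ℝ}
    [IsProbabilityMeasure β] {Xs : Fin n → Ω → Fin p → ℝ} {mask : Fin n → Fin p → Ω → ℝ}
    (hXs : ∀ i, HasLaw (Xs i) ν μ) (hXind : iIndepFun Xs μ)
    (hmask : ∀ i j, HasLaw (mask i j) β μ)
    (hmind : iIndepFun (fun (k : Fin n × Fin p) ω => mask k.1 k.2 ω) μ)
    (hind : IndepFun (fun ω i => Xs i ω) (fun ω i j => mask i j ω) μ) :
    HasLaw (fun ω i => (Xs i ω, fun j => mask i j ω))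
      (Measure.pi fun _ => ν.prod (Measure.pi fun _ => β)) μ := by
  have h₁ := hXind.hasLaw_pi hXs
  have h₂ := (measurePreserving_curry_pi (n := n) (p := p) β).fun_comp_hasLaw
    (hmind.hasLaw_pi fun k => hmask k.1 k.2)
  have h₃ := hind.hasLaw_prod h₁ h₂
  exact (measurePreserving_arrowProdEquivProdArrow (Fin p → ℝ) (Fin p → ℝ) (Fin n)
    (fun _ => ν) (fun _ => Measure.pi fun _ => β)).symm.fun_comp_hasLaw h₃

end Laws

/-! ### The corrected matrix and existence of maximizers -/

section Deterministic

variable {n p : ℕ}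

theorem dotProduct_correctedCov_mulVec (δ : ℝ) (x m : Fin n → Fin p → ℝ) (v : Fin p → ℝ) :
    v ⬝ᵥ correctedCov δ (maskedData x m) *ᵥ v = (n : ℝ)⁻¹ * ∑ i, sampleForm δ v (x i) (m i) := by
  have hentry : ∀ j k, correctedCov δ (maskedData x m) j k
      = (n : ℝ)⁻¹ * ∑ i, (if j = k then δ⁻¹ else (δ ^ 2)⁻¹) * ((x i j * x i k) * (m i j * m i k)) := by
    intro j k
    simp only [correctedCov, empiricalCov, maskedData, Matrix.add_apply, Matrix.smul_apply,
      Matrix.diagonal_apply, Matrix.diag_apply, Matrix.sum_apply, Matrix.vecMulVec_apply,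
      smul_eq_mul]
    split_ifs with h
    · subst h
      rw [← Finset.mul_sum]
      have : ∀ i, m i j * x i j * (m i j * x i j) = x i j * x i j * (m i j * m i j) :=
        fun i => by ring
      simp only [this]
      ring
    · rw [← Finset.mul_sum]
      have : ∀ i, m i j * x i j * (m i k * x i k) = x i j * x i k * (m i j * m i k) :=
        fun i => by ring
      simp only [this]
      ring
  simp only [sampleForm_eq_sum, dotProduct, Matrix.mulVec, hentry, Finset.mul_sum, Finset.sum_mul]
  rw [Finset.sum_comm (γ := Fin n)]
  refine Finset.sum_congr rfl fun j _ => ?_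
  rw [Finset.sum_comm (γ := Fin n)]
  refine Finset.sum_congr rfl fun k _ => Finset.sum_congr rfl fun i _ => ?_
  ring

theorem transpose_correctedCov (δ : ℝ) (y : Fin n → Fin p → ℝ) :
    (correctedCov δ y)ᵀ = correctedCov δ y := by
  simp [correctedCov, empiricalCov, Matrix.transpose_sum, Matrix.transpose_vecMulVec]

theorem transpose_secondMomentMatrix {Ω : Type*} [MeasurableSpace Ω] (X : Ω → Fin p → ℝ)
    (μ : Measure Ω) : (secondMomentMatrix X μ)ᵀ = secondMomentMatrix X μ := by
  ext j k
  simp only [secondMomentMatrix, Matrix.transpose_apply, Matrix.of_apply, mul_comm]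

/-- The support size is a sum of indicators of the open sets `v j ≠ 0`. This yields both the
closedness of the sparsity constraint and the semicontinuity of the penalized objective. -/
theorem lowerSemicontinuous_mul_hammingNorm {lam : ℝ} (hlam : 0 ≤ lam) :
    LowerSemicontinuous fun v : Fin p → ℝ => lam * (hammingNorm v : ℝ) := by
  have h : (fun v : Fin p → ℝ => lam * (hammingNorm v : ℝ))
      = fun v => ∑ j, Set.indicator {v : Fin p → ℝ | v j ≠ 0} (fun _ => lam) v := by
    ext v
    simp only [hammingNorm, Set.indicator_apply, Set.mem_ofPred_eq]
    rw [← Finset.sum_filter, Finset.sum_const, nsmul_eq_mul, mul_comm]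
  rw [h]
  refine lowerSemicontinuous_sum fun j _ => IsOpen.lowerSemicontinuous_indicator ?_ hlam
  exact isOpen_ne_fun (continuous_apply j) continuous_const

theorem exists_isSparsePCAEstimator (S : Matrix (Fin p) (Fin p) ℝ) {sbar lam : ℝ} (hlam : 0 ≤ lam)
    {θ₁ : Fin p → ℝ} (hθ₁ : θ₁ ∈ unitSphere p) (hs : (hammingNorm θ₁ : ℝ) ≤ sbar) :
    ∃ θ, IsSparsePCAEstimator S sbar lam θ := by
  have hcompact : IsCompact {v : Fin p → ℝ | v ∈ unitSphere p ∧ (hammingNorm v : ℝ) ≤ sbar} := by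
    have hsphere : IsCompact (unitSphere p) := by
      refine Metric.isCompact_of_isClosed_isBounded
        (isClosed_eq (by fun_prop) continuous_const) ?_
      refine (Metric.isBounded_closedBall (x := (0 : Fin p → ℝ)) (r := 1)).subset fun v hv => ?_
      rw [mem_closedBall_zero_iff, pi_norm_le_iff_of_nonneg zero_le_one]
      intro j
      rw [Real.norm_eq_abs, ← sq_le_one_iff_abs_le_one, ← show ∑ j, v j ^ 2 = 1 from hv]
      exact Finset.single_le_sum (f := fun j => v j ^ 2) (fun k _ => sq_nonneg _)
        (Finset.mem_univ j)
    have hclosed : IsClosed {v : Fin p → ℝ | (hammingNorm v : ℝ) ≤ sbar} := by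
      have h := (lowerSemicontinuous_mul_hammingNorm (p := p) zero_le_one).isClosed_preimage sbar
      simp only [one_mul] at h
      exact h
    exact hsphere.inter_right hclosed
  have hcont : Continuous fun v : Fin p → ℝ => -(v ⬝ᵥ S *ᵥ v) := by fun_prop
  obtain ⟨θ, hθ, hmin⟩ := LowerSemicontinuousOn.exists_isMinOn
    (s := {v : Fin p → ℝ | v ∈ unitSphere p ∧ (hammingNorm v : ℝ) ≤ sbar}) ⟨θ₁, hθ₁, hs⟩ hcompact
    (((lowerSemicontinuous_mul_hammingNorm hlam).add
      hcont.lowerSemicontinuous).lowerSemicontinuousOn _)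
  refine ⟨θ, hθ, fun v hv => ?_⟩
  have h := hmin hv
  simp only [Set.mem_ofPred_eq] at h ⊢
  linarith

end Deterministic

/-! ### Basic inequality and conclusion -/

/-- The basic inequality for the penalized estimator, given a bound `c` on the stochastic error
over the joint support. -/
theorem two_mul_le_of_basic_inequality {σ₁ σ₂ D c C C₀ L lam q q₁ : ℝ} {s s₁ : ℕ} (hσ : σ₂ < σ₁)
    (hσ₁ : 0 < σ₁) (hD : 0 ≤ D) (hL : 0 ≤ L) (hC : C₀ ≤ C)
    (hc : 8 * c ^ 2 ≤ C₀ * σ₁ ^ 2 * ((s + s₁) * L)) (hlam : lam = C * (σ₁ ^ 2 / (σ₁ - σ₂)) * L)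
    (hmax : q₁ - lam * s₁ ≤ q - lam * s)
    (hdev : q - q₁ ≤ 4 * c * √D - (σ₁ - σ₂) * D) :
    2 * D ≤ 8 * C * s₁ * (σ₁ / (σ₁ - σ₂)) ^ 2 * L := by
  set g := σ₁ - σ₂ with hg
  have hg0 : 0 < g := by rw [hg]; linarith
  have hsq : √D * √D = D := Real.mul_self_sqrt hD
  have hamgm : 4 * c * √D ≤ g * D / 2 + 8 * c ^ 2 / g := by
    have h₁ : 0 ≤ (g * √D - 4 * c) ^ 2 / (2 * g) := by positivity
    have h₂ : (g * √D - 4 * c) ^ 2 / (2 * g) = g * (√D * √D) / 2 - 4 * c * √D + 8 * c ^ 2 / g := by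
      field_simp
      ring
    rw [h₂, hsq] at h₁
    linarith
  -- The noise is at most `lam * (s + s₁)`, which is what `C₀ ≤ C` is for; combined with `hmax`, the
  -- unknown `s` cancels.
  have hc' : 8 * c ^ 2 / g ≤ C * (σ₁ ^ 2 / g) * L * (s + s₁) := by
    rw [div_le_iff₀ hg0]
    calc 8 * c ^ 2 ≤ C₀ * σ₁ ^ 2 * ((s + s₁) * L) := hc
      _ ≤ C * σ₁ ^ 2 * ((s + s₁) * L) := by gcongr
      _ = C * (σ₁ ^ 2 / g) * L * (s + s₁) * g := by field_simp
  have hfin : g * D ≤ 4 * (C * (σ₁ ^ 2 / g) * L) * s₁ := by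
    rw [hlam] at hmax
    linarith
  have h₁ : D ≤ 4 * (C * (σ₁ ^ 2 / g) * L) * s₁ / g := by
    rw [le_div_iff₀ hg0]
    linarith
  calc 2 * D ≤ 2 * (4 * (C * (σ₁ ^ 2 / g) * L) * s₁ / g) := by linarith
    _ = 8 * C * s₁ * (σ₁ / g) ^ 2 * L := by
        field_simp
        ring

theorem one_le_hammingNorm_of_mem_unitSphere {p : ℕ} {θ : Fin p → ℝ} (hθ : θ ∈ unitSphere p) :
    1 ≤ hammingNorm θ := by
  rw [Nat.one_le_iff_ne_zero, hammingNorm_ne_zero_iff]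
  rintro rfl
  simp [unitSphere] at hθ

theorem deviation_level_sq_le {p n k : ℕ} {κ δ : ℝ} (hδ : 0 < δ) (hn : 0 < n)
    (hk : 1 ≤ k) (hkp : k ≤ p) :
    8 * (192 * (κ / δ) * √(sparseEntropy p k / n)) ^ 2
      ≤ 589824 * κ ^ 2 * (k * (Real.log (Real.exp 1 * p) / (δ ^ 2 * n))) := by
  have hn' : (0 : ℝ) < n := by exact_mod_cast hn
  have h₀ := sparseEntropy_nonneg hk hkp
  rw [mul_pow, mul_pow, Real.sq_sqrt (by positivity)]
  calc 8 * (192 ^ 2 * (κ / δ) ^ 2 * (sparseEntropy p k / n))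
      ≤ 8 * (192 ^ 2 * (κ / δ) ^ 2 * (2 * k * Real.log (Real.exp 1 * p) / n)) := by
        gcongr
        exact sparseEntropy_le hk hkp
    _ = _ := by
        field_simp
        ring

/-- The error bound on the event where the stochastic error is controlled on the nets. -/
theorem IsSparsePCAEstimator.schattenTwo_sq_le {p n : ℕ} {S T : Matrix (Fin p) (Fin p) ℝ}
    {c₁ C δ σ₁ σ₂ sbar lam : ℝ} {θ₁ θ : Fin p → ℝ} (hc₁ : 0 < c₁) (hδ : 0 < δ) (hn : 0 < n)
    (hC : 2359296 / c₁ ^ 2 ≤ C) (hS : Sᵀ = S) (hT : Tᵀ = T) (hcov : IsSpikedCovariance T σ₁ σ₂ θ₁)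
    (hlam : lam = C * (σ₁ ^ 2 / (σ₁ - σ₂)) * (Real.log (Real.exp 1 * p) / (δ ^ 2 * n)))
    (hs₁ : (hammingNorm θ₁ : ℝ) ≤ sbar)
    (hgood : ∀ J : Finset (Fin p), J.card ≠ 0 → (J.card : ℝ) ≤ 2 * sbar →
      ∀ v ∈ (exists_net_controlling_quadraticForm J).choose,
        |v ⬝ᵥ (S - T) *ᵥ v|
          ≤ 192 * (2 * σ₁ / c₁ / δ) * √(sparseEntropy p J.card / n))
    (hθ : IsSparsePCAEstimator S sbar lam θ) :
    schattenTwo (Matrix.vecMulVec θ θ - Matrix.vecMulVec θ₁ θ₁) ^ 2 ≤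
      8 * C * (hammingNorm θ₁ : ℝ) * (σ₁ / (σ₁ - σ₂)) ^ 2 *
        (Real.log (Real.exp 1 * p) / (δ ^ 2 * n)) := by
  classical
  obtain ⟨⟨hθu, hθs⟩, hmax⟩ := hθ
  have hθ₁ := hcov.2.2.1
  have hσ₁ : 0 < σ₁ := hcov.1.trans_lt hcov.2.1
  -- The joint support is random through `θ`, so `hgood` has to hold for all supports at once.
  set J : Finset (Fin p) := Finset.univ.filter (fun j => θ j ≠ 0) ∪
    Finset.univ.filter (fun j => θ₁ j ≠ 0) with hJ
  have hJle : J.card ≤ hammingNorm θ + hammingNorm θ₁ := Finset.card_union_le _ _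
  have hJle' : (J.card : ℝ) ≤ hammingNorm θ + hammingNorm θ₁ := by exact_mod_cast hJle
  have hJ1 : 1 ≤ J.card :=
    (one_le_hammingNorm_of_mem_unitSphere hθ₁).trans (Finset.card_le_card Finset.subset_union_right)
  have hJp : J.card ≤ p := by simpa using J.card_le_univ
  have hL : 0 ≤ Real.log (Real.exp 1 * p) / (δ ^ 2 * n) := by
    have h₁ := one_le_log_exp_one_mul_div one_pos
      (show (1 : ℝ) ≤ p by exact_mod_cast hJ1.trans hJp)
    rw [div_one] at h₁
    positivity
  have hnet := (exists_net_controlling_quadraticForm J).choose_spec.2.2 (S - T)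
    (by rw [Matrix.transpose_sub, hS, hT]) _ (hgood J (by omega) (by linarith)) θ hθu θ₁ hθ₁
    (fun j hj => by
      by_contra h
      exact hj (Finset.mem_union_left _ (by simpa using h)))
    (fun j hj => by
      by_contra h
      exact hj (Finset.mem_union_right _ (by simpa using h)))
  have hlevel := deviation_level_sq_le (κ := 2 * σ₁ / c₁) hδ hn hJ1 hJp
  set c := 192 * (2 * σ₁ / c₁ / δ) * √(sparseEntropy p J.card / n)
  rw [schattenTwo_vecMulVec_sub_sq hθu hθ₁]
  refine two_mul_le_of_basic_inequality hcov.2.1 hσ₁ (one_sub_dotProduct_sq_nonneg hθu hθ₁) hL hC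
    (c := c) (s := hammingNorm θ) ?_ hlam (hmax ⟨hθ₁, hs₁⟩) ?_
  · refine hlevel.trans ?_
    calc 589824 * (2 * σ₁ / c₁) ^ 2 * (J.card * (Real.log (Real.exp 1 * p) / (δ ^ 2 * n)))
        = 2359296 / c₁ ^ 2 * σ₁ ^ 2 *
          (J.card * (Real.log (Real.exp 1 * p) / (δ ^ 2 * n))) := by
          rw [div_pow, mul_pow]
          ring
      _ ≤ _ := by gcongr
  · have h₁ := hcov.quadraticForm_le hθu
    have h₂ := hcov.quadraticForm_self
    have h₃ := (abs_le.1 hnet).2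
    simp only [Matrix.sub_mulVec, dotProduct_sub] at h₃
    linarith

theorem theorem1 (c₁ : ℝ) (hc₁ : 0 < c₁) :
    ∃ C₀ : ℝ, 0 < C₀ ∧ ∀ C : ℝ, C₀ ≤ C → ∃ C' : ℝ, 0 < C' ∧
      ∀ (Ω : Type*) [MeasurableSpace Ω] (μ : Measure Ω) [IsProbabilityMeasure μ]
        (n p : ℕ) (X : Ω → Fin p → ℝ) (Xs : Fin n → Ω → Fin p → ℝ)
        (mask : Fin n → Fin p → Ω → ℝ) (δ : ℝ) (hδ₀ : 0 < δ) (hδ₁ : δ ≤ 1)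
        (σ₁ σ₂ : ℝ) (θ₁ : Fin p → ℝ) (sbar lam : ℝ),
        -- `X, X₁, …, Xₙ` are identically distributed and `X₁, …, Xₙ` are independent
        (∀ i, IdentDistrib (Xs i) X μ μ) → iIndepFun Xs μ →
        -- centered, with covariance matrix of the spiked form, and sub-Gaussian
        (∀ j, ∫ ω, X ω j ∂μ = 0) →
        IsSpikedCovariance (secondMomentMatrix X μ) σ₁ σ₂ θ₁ →
        SubGaussianObservations c₁ X μ →
        -- the masks are i.i.d. Bernoulli with parameter `δ`, independent of the sample
        (∀ i j, HasLaw (mask i j) (bernoulliMeasure (1 : ℝ) 0 ⟨δ, hδ₀.le, hδ₁⟩) μ) →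
        iIndepFun (fun (k : Fin n × Fin p) ω => mask k.1 k.2 ω) μ →
        IndepFun (fun ω i => Xs i ω) (fun ω i j => mask i j ω) μ →
        -- tuning parameters
        sbar ≤ p →
        (δ ^ 2)⁻¹ * (sbar + 1) * Real.log (Real.exp 1 * p / sbar) ≤ n →
        lam = C * (σ₁ ^ 2 / (σ₁ - σ₂)) * (Real.log (Real.exp 1 * p) / (δ ^ 2 * n)) →
        (hammingNorm θ₁ : ℝ) ≤ sbar →
        -- maximisers exist, and with probability at least `1 - 1/p` they all satisfy the bound
        (∀ ω, ∃ θ, IsSparsePCAEstimator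
          (correctedCov δ (maskedData (fun i => Xs i ω) (fun i j => mask i j ω))) sbar lam θ) ∧
        ∃ A : Set Ω, MeasurableSet A ∧ 1 - 1 / (p : ℝ) ≤ μ.real A ∧
          ∀ ω ∈ A, ∀ θ, IsSparsePCAEstimator
            (correctedCov δ (maskedData (fun i => Xs i ω) (fun i j => mask i j ω))) sbar lam θ →
            schattenTwo (Matrix.vecMulVec θ θ - Matrix.vecMulVec θ₁ θ₁) ^ 2 ≤
              C' * (hammingNorm θ₁ : ℝ) * (σ₁ / (σ₁ - σ₂)) ^ 2 *
                (Real.log (Real.exp 1 * p) / (δ ^ 2 * n)) := by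
  -- `2359296 = 4 * 589824`: the constant of `deviation_level_sq_le` at `κ = 2 * σ₁ / c₁`.
  refine ⟨2359296 / c₁ ^ 2, by positivity, fun C hC => ?_⟩
  have hC0 : 0 < C := lt_of_lt_of_le (by positivity) hC
  refine ⟨8 * C, by positivity, ?_⟩
  intro Ω _ μ _ n p X Xs mask δ hδ₀ hδ₁ σ₁ σ₂ θ₁ sbar lam hident hXind _ hcov hsub hmask hmind hind
    hsp hn hlam hs₁
  have hθ₁ := hcov.2.2.1
  have hσ₁ : 0 < σ₁ := hcov.1.trans_lt hcov.2.1
  have hσ : 0 < σ₁ - σ₂ := sub_pos.2 hcov.2.1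
  have hs : 1 ≤ sbar :=
    le_trans (by exact_mod_cast one_le_hammingNorm_of_mem_unitSphere hθ₁) hs₁
  have hp1 : (1 : ℝ) ≤ p := hs.trans hsp
  have hn0 : 0 < n := by
    have h₁ := one_le_log_exp_one_mul_div (by linarith) hsp
    have h₂ : 0 < (δ ^ 2)⁻¹ * (sbar + 1) * Real.log (Real.exp 1 * p / sbar) := by positivity
    exact_mod_cast h₂.trans_le hn
  have hlam0 : 0 ≤ lam := by
    have h₁ := one_le_log_exp_one_mul_div one_pos hp1
    rw [div_one] at h₁
    rw [hlam]
    positivity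
  refine ⟨fun ω => exists_isSparsePCAEstimator _ hlam0 hθ₁ hs₁, ?_⟩
  have hX : AEMeasurable X μ := (hident ⟨0, hn0⟩).aemeasurable_snd
  have : IsProbabilityMeasure (μ.map X) := Measure.isProbabilityMeasure_map hX
  set β := bernoulliMeasure (1 : ℝ) 0 ⟨δ, hδ₀.le, hδ₁⟩
  have hlaw := hasLaw_sample (ν := μ.map X)
    (fun i => ⟨(hident i).aemeasurable_fst, (hident i).map_eq⟩) hXind hmask hmind hind
  have hbad := measure_exists_support_le (n := n) (ν := μ.map X) (κ := 2 * σ₁ / c₁)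
    (by positivity) (fun v hv => hsub.lintegral_exp_le hc₁ hX hcov hv) hδ₀ hδ₁
    (isBernoulliMask_pi_bernoulliMeasure p hδ₀.le hδ₁) hs hsp hn
    (N := fun J => (exists_net_controlling_quadraticForm J).choose)
    (fun J => (exists_net_controlling_quadraticForm J).choose_spec.1)
    (fun J => (exists_net_controlling_quadraticForm J).choose_spec.2.1)
  rw [← hlaw.map_eq, secondMomentMatrix_map hX] at hbad
  set bad := (fun ω i => (Xs i ω, fun j => mask i j ω)) ⁻¹' {z | ∃ J : Finset (Fin p),
    J.card ≠ 0 ∧ (J.card : ℝ) ≤ 2 * sbar ∧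
      ∃ v ∈ (exists_net_controlling_quadraticForm J).choose,
        n * (192 * (2 * σ₁ / c₁ / δ) * √(sparseEntropy p J.card / n)) ≤
          |∑ i : Fin n, (sampleForm δ v (z i).1 (z i).2
            - v ⬝ᵥ secondMomentMatrix X μ *ᵥ v)|} with hbaddef
  have hbad' : μ bad ≤ ENNReal.ofReal (1 / p) :=
    (Measure.le_map_apply hlaw.aemeasurable _).trans hbad
  -- The data are only a.e. measurable, so `bad` is replaced by a measurable hull of the same
  -- measure.
  refine ⟨(toMeasurable μ bad)ᶜ, (measurableSet_toMeasurable μ bad).compl, ?_, ?_⟩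
  · rw [probReal_compl_eq_one_sub (measurableSet_toMeasurable μ bad), measureReal_def,
      measure_toMeasurable]
    gcongr
    exact ENNReal.toReal_le_of_le_ofReal (by positivity) hbad'
  · intro ω hω θ hθ
    have hωbad : ω ∉ bad := fun h => hω (subset_toMeasurable μ bad h)
    refine hθ.schattenTwo_sq_le hc₁ hδ₀ hn0 hC (transpose_correctedCov _ _)
      (transpose_secondMomentMatrix X μ) hcov hlam hs₁ fun J hJ0 hJ2 v hv => ?_
    by_contra! hlt
    refine hωbad ⟨J, hJ0, hJ2, v, hv, ?_⟩
    have hn' : (0 : ℝ) < n := by exact_mod_cast hn0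
    rw [Matrix.sub_mulVec, dotProduct_sub, dotProduct_correctedCov_mulVec] at hlt
    have h₁ : ∑ i, (sampleForm δ v (Xs i ω) (fun j => mask i j ω)
        - v ⬝ᵥ secondMomentMatrix X μ *ᵥ v)
        = n * ((n : ℝ)⁻¹ * ∑ i, sampleForm δ v (Xs i ω) (fun j => mask i j ω)
          - v ⬝ᵥ secondMomentMatrix X μ *ᵥ v) := by
      rw [Finset.sum_sub_distrib, Finset.sum_const, Finset.card_univ, Fintype.card_fin,
        nsmul_eq_mul]
      field_simp
    change _ ≤ |∑ i, (sampleForm δ v (Xs i ω) (fun j => mask i j ω)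
        - v ⬝ᵥ secondMomentMatrix X μ *ᵥ v)|
    rw [h₁, abs_mul, abs_of_pos hn']
    gcongr
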